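/- Let $1\le k\le n+1$. Let $\mathbb{L}^{n+3}=W_1\oplus W_2$ be the orthogonal sum of the Lorentzian space $W_1=\mathbb{L}^{k+1}$, with inner product $-x_0y_0+x_1y_1+\dots+x_ky_k$, and the Euclidean space $W_2=\mathbb{R}^{n-k+2}$. Let $\mathbb{H}^k=\{x\in W_1:\langle x,x\rangle=-1,\ x_0>0\}$, let $\mathbb{S}^{n-k+1}$ be the unit sphere of $W_2$, and give $\mathbb{H}^k\times\mathbb{S}^{n-k+1}\subset\mathbb{L}^{n+3}$ the induced Riemannian metric. Let $O_1(k+1)$ be the group of linear isometries of $W_1$ that preserve $\mathbb{H}^k$, and $O(n-k+2)$ the orthogonal group of $W_2$. Let $V\subset\mathbb{L}^{n+3}$ be a space-like subspace of dimension $p$, and let $S=(\mathbb{H}^k\times\mathbb{S}^{n-k+1})\cap V^\perp$. Assume that $S$ is substantial, that is, not contained in a totally geodesic submanifold of $\mathbb{H}^k\times\mathbb{S}^{n-k+1}$ of positive codimension. For $i=1,2$ let $U_i=V^\perp\cap W_i$, and let $U_i^\perp$ be the orthogonal complement of $U_i$ in $W_i$. Let $O(U_1^\perp)$ (respectively $O(U_2^\perp)$)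 be the subgroup of the elements of $O_1(k+1)$ (respectively $O(n-k+2)$) that fix $U_1^\perp$ (respectively $U_2^\perp$) pointwise. The cohomogeneity of an action on $S$ is $\dim S$ minus the largest dimension of an orbit, and a point of $S$ is regular if its orbit has this largest dimension. Then: (i) If $p\le k-1$, the subgroup $O(U_1^\perp)\times\{I\}$ of $O_1(k+1)\times O(n-k+2)$ leaves $S$ invariant and acts on $S$ with cohomogeneity $n-k+1$. The orbit of each $(x,y)\in S$ is $V^\perp\cap(\mathbb{H}^k\times\{y\})$, and if $(x,y)$ is a regular point, this orbit is a $(k-p)$-dimensional umbilical submanifold of $\mathbb{H}^k\times\mathbb{S}^{n-k+1}$. (ii) If $p\le n-k$, the subgroup $\{I\}\times O(U_2^\perp)$ of $O_1(k+1)\times O(n-k+2)$ leaves $S$ invariant and acts on $S$ with cohomogeneity $k$. The orbit of each $(x,y)\in S$ is $V^\perp\cap(\{x\}\times\mathbb{S}^{n-k+1})$, and if $(x,y)$ is a regular point, this orbit is an $(n-k-p+1)$-dimensional round sphere, that is, $\{x\}\times N$ where $N$ is a sphere of positive radius in an affine subspace of $W_2$ of dimension $n-k-p+2$. -/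

import Mathlib

open Module Filter Topology
open scoped ContDiff

namespace UmbilicalRotation

/-! ### Submanifolds of a vector space, tangent and normal vectors, second fundamental form -/

section Submanifolds

variable {E : Type*} [NormedAddCommGroup E] [NormedSpace ℝ E]

/-- `N` is an embedded smooth submanifold of dimension `d` of the finite-dimensional vector
space `E`: near each of its points it is the zero set of a smooth map with values in `ℝ^c`,
`d + c = dim E`, whose differential is onto at the points of `N`. -/
def IsSubmanifold (d : ℕ) (N : Set E) : Prop :=
  ∃ c : ℕ, d + c = finrank ℝ E ∧
    ∀ z ∈ N, ∃ (O : Set E) (f : E → EuclideanSpace ℝ (Fin c)),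
      IsOpen O ∧ z ∈ O ∧ ContDiffOn ℝ ∞ f O ∧
      (∀ w ∈ N ∩ O, Function.Surjective (fderiv ℝ f w)) ∧
      N ∩ O = {w ∈ O | f w = 0}

/-- `γ` is a smooth curve, considered near the time `0`, that lies in `N` and passes through `z`
at the time `0`. -/
def IsCurveThrough (N : Set E) (z : E) (γ : ℝ → E) : Prop :=
  ContDiffAt ℝ ∞ γ 0 ∧ γ 0 = z ∧ ∀ᶠ t in 𝓝 (0 : ℝ), γ t ∈ N

/-- The tangent vectors of `N` at `z`: the velocities of the smooth curves in `N` through `z`. -/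
def tangentVectors (N : Set E) (z : E) : Set E :=
  {v | ∃ γ : ℝ → E, IsCurveThrough N z γ ∧ deriv γ 0 = v}

/-- The vectors that are tangent to `M` and orthogonal to `N` at `z`, for the inner product `B`. -/
def normalVectors (B : LinearMap.BilinForm ℝ E) (M N : Set E) (z : E) : Set E :=
  {η | η ∈ tangentVectors M z ∧ ∀ v ∈ tangentVectors N z, B v η = 0}

/-- `N` is an umbilical `d`-dimensional submanifold of the submanifold `M` of `E`, where `M`
carries the metric induced by `B`: at each point `z` of `N` there is a normal vector `H` such that
the second fundamental form `α` of `N` in `M` is `α(X, Y) = ⟨X, Y⟩ H`. For a curve `γ` in `N`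
through `z` with velocity `X`, `α(X, X)` is the component of `γ''(0)` in the normal space of
`N` in `M`; since `α` is symmetric, it is enough to ask `α(X, X) = ⟨X, X⟩ H` for all `X`. -/
def IsUmbilicalSubmanifold (B : LinearMap.BilinForm ℝ E) (M : Set E) (d : ℕ) (N : Set E) : Prop :=
  IsSubmanifold d N ∧ N ⊆ M ∧
    ∀ z ∈ N, ∃ H ∈ normalVectors B M N z, ∀ γ : ℝ → E, IsCurveThrough N z γ →
      ∀ η ∈ normalVectors B M N z,
        B (deriv (deriv γ) 0) η = B (deriv γ 0) (deriv γ 0) * B H η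

/-- `N` is a totally geodesic `d`-dimensional submanifold of the submanifold `M` of `E`, where
`M` carries the metric induced by `B`: the second fundamental form of `N` in `M` vanishes. -/
def IsTotallyGeodesicSubmanifold (B : LinearMap.BilinForm ℝ E) (M : Set E) (d : ℕ)
    (N : Set E) : Prop :=
  IsSubmanifold d N ∧ N ⊆ M ∧
    ∀ z ∈ N, ∀ γ : ℝ → E, IsCurveThrough N z γ →
      ∀ η ∈ normalVectors B M N z, B (deriv (deriv γ) 0) η = 0

/-- A subset `S` of the `m`-dimensional submanifold `M` is substantial if it is not contained in
a totally geodesic submanifold of `M` of positive codimension. -/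
def IsSubstantial (B : LinearMap.BilinForm ℝ E) (M : Set E) (m : ℕ) (S : Set E) : Prop :=
  ¬ ∃ d < m, ∃ N : Set E, IsTotallyGeodesicSubmanifold B M d N ∧ S ⊆ N

/-- `B` is positive definite on `V`. -/
def IsSpacelike (B : LinearMap.BilinForm ℝ E) (V : Submodule ℝ E) : Prop :=
  ∀ v ∈ V, v ≠ 0 → 0 < B v v

end Submanifolds

/-! ### The Lorentzian space `W₁ ⊕ W₂` and the product of hyperbolic space and sphere -/

/-- The underlying vector space of the Lorentzian summand `W₁ = 𝕃^{k+1}`. -/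
abbrev W₁ (k : ℕ) : Type := EuclideanSpace ℝ (Fin (k + 1))

/-- The Euclidean summand `W₂ = ℝ^{n-k+2}` (for `k ≤ n + 1`). -/
abbrev W₂ (n k : ℕ) : Type := EuclideanSpace ℝ (Fin (n + 2 - k))

/-- The underlying vector space of `𝕃^{n+3} = W₁ ⊕ W₂`. -/
abbrev Ambient (n k : ℕ) : Type := W₁ k × W₂ n k

/-- The Lorentzian inner product `-x₀ y₀ + x₁ y₁ + ⋯ + x_k y_k` of `W₁`. -/
noncomputable def lorentzForm (k : ℕ) : LinearMap.BilinForm ℝ (W₁ k) :=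
  LinearMap.mk₂ ℝ (fun x y => -(x 0 * y 0) + ∑ i : Fin k, x i.succ * y i.succ)
    (by intro x x' y; simp [add_mul, Finset.sum_add_distrib]; ring)
    (by intro c x y; simp [mul_assoc, Finset.mul_sum, mul_add])
    (by intro x y y'; simp [mul_add, Finset.sum_add_distrib]; ring)
    (by intro c x y; simp [mul_left_comm, Finset.mul_sum, mul_add])

/-- The Lorentzian inner product of `𝕃^{n+3}`, for which `W₁` and `W₂` are orthogonal. -/
noncomputable def ambientForm (n k : ℕ) : LinearMap.BilinForm ℝ (Ambient n k) :=
  LinearMap.mk₂ ℝ (fun z w => lorentzForm k z.1 w.1 + inner ℝ z.2 w.2)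
    (by intro x x' y; simp [inner_add_left]; ring)
    (by intro c x y; simp [inner_smul_left, mul_add])
    (by intro x y y'; simp [inner_add_right]; ring)
    (by intro c x y; simp [inner_smul_right, mul_add])

/-- Hyperbolic space `ℍ^k`, the upper sheet of the hyperboloid in `W₁`. -/
def hyperbolicSpace (k : ℕ) : Set (W₁ k) :=
  {x | lorentzForm k x x = -1 ∧ 0 < x 0}

/-- The unit sphere `𝕊^{n-k+1}` of `W₂`. -/
def unitSphere (n k : ℕ) : Set (W₂ n k) := {y | ‖y‖ = 1}

/-- The product `ℍ^k × 𝕊^{n-k+1}`, of dimension `n + 1`. -/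
def productSpace (n k : ℕ) : Set (Ambient n k) := hyperbolicSpace k ×ˢ unitSphere n k

/-- The orthogonal complement `V^⊥` of `V` in `𝕃^{n+3}`. -/
noncomputable def perp {n k : ℕ} (V : Submodule ℝ (Ambient n k)) : Submodule ℝ (Ambient n k) :=
  (ambientForm n k).orthogonal V

/-- The submanifold `S = (ℍ^k × 𝕊^{n-k+1}) ∩ V^⊥`. -/
def slice {n k : ℕ} (V : Submodule ℝ (Ambient n k)) : Set (Ambient n k) :=
  productSpace n k ∩ (perp V : Set (Ambient n k))

/-- `U₁ = V^⊥ ∩ W₁`, as a subspace of `W₁`. -/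
noncomputable def U₁ {n k : ℕ} (V : Submodule ℝ (Ambient n k)) : Submodule ℝ (W₁ k) :=
  (perp V).comap (LinearMap.inl ℝ (W₁ k) (W₂ n k))

/-- `U₂ = V^⊥ ∩ W₂`, as a subspace of `W₂`. -/
noncomputable def U₂ {n k : ℕ} (V : Submodule ℝ (Ambient n k)) : Submodule ℝ (W₂ n k) :=
  (perp V).comap (LinearMap.inr ℝ (W₁ k) (W₂ n k))

/-! ### The groups -/

/-- The group `O₁(k+1)`, acting on `ℍ^k`: the linear isometries of the Lorentzian space `W₁`
that preserve `ℍ^k`. -/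
def lorentzGroup (k : ℕ) : Subgroup (W₁ k ≃ₗ[ℝ] W₁ k) where
  carrier := {T | (∀ x y, lorentzForm k (T x) (T y) = lorentzForm k x y) ∧
    ∀ x, T x ∈ hyperbolicSpace k ↔ x ∈ hyperbolicSpace k}
  mul_mem' := by
    rintro S T ⟨hS, hS'⟩ ⟨hT, hT'⟩
    exact ⟨fun x y => by simp [LinearEquiv.mul_apply, hS, hT],
      fun x => by simp [LinearEquiv.mul_apply, hS', hT']⟩
  one_mem' := ⟨fun _ _ => rfl, fun _ => Iff.rfl⟩
  inv_mem' := by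
    rintro T ⟨hT, hT'⟩
    have key : ∀ x, T (T⁻¹ x) = x := fun x => T.apply_symm_apply x
    refine ⟨fun x y => ?_, fun x => ?_⟩
    · rw [← hT, key, key]
    · rw [← hT', key]

/-- The orthogonal group `O(n-k+2)` of the Euclidean space `W₂`. -/
def orthogonalGroup (n k : ℕ) : Subgroup (W₂ n k ≃ₗ[ℝ] W₂ n k) where
  carrier := {T | ∀ x y, inner ℝ (T x) (T y) = inner ℝ x y}
  mul_mem' := by
    intro S T hS hT x y
    change inner ℝ (S (T x)) (S (T y)) = inner ℝ x y
    rw [hS, hT]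
  one_mem' := fun _ _ => rfl
  inv_mem' := by
    intro T hT x y
    have key : ∀ x, T (T⁻¹ x) = x := fun x => T.apply_symm_apply x
    rw [← hT, key, key]

/-- The group `O(U₁^⊥)` of the elements of `O₁(k+1)` that fix pointwise the orthogonal complement
`U₁^⊥` of `U₁` in `W₁`. -/
noncomputable def O₁ {n k : ℕ} (V : Submodule ℝ (Ambient n k)) : Subgroup (W₁ k ≃ₗ[ℝ] W₁ k) :=
  lorentzGroup k ⊓
    fixingSubgroup (W₁ k ≃ₗ[ℝ] W₁ k) (((lorentzForm k).orthogonal (U₁ V) : Set (W₁ k)))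

/-- The group `O(U₂^⊥)` of the elements of `O(n-k+2)` that fix pointwise the orthogonal complement
`U₂^⊥` of `U₂` in `W₂`. -/
noncomputable def O₂ {n k : ℕ} (V : Submodule ℝ (Ambient n k)) :
    Subgroup (W₂ n k ≃ₗ[ℝ] W₂ n k) :=
  orthogonalGroup n k ⊓
    fixingSubgroup (W₂ n k ≃ₗ[ℝ] W₂ n k) (((U₂ V)ᗮ : Submodule ℝ (W₂ n k)) : Set (W₂ n k))

/-- Pairs of linear automorphisms of `W₁` and `W₂`. -/
abbrev Pairs (n k : ℕ) : Type := (W₁ k ≃ₗ[ℝ] W₁ k) × (W₂ n k ≃ₗ[ℝ] W₂ n k)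

/-- The subgroup `O(U₁^⊥) × {I}` of `O₁(k+1) × O(n-k+2)`. -/
noncomputable def G₁ {n k : ℕ} (V : Submodule ℝ (Ambient n k)) : Subgroup (Pairs n k) :=
  (O₁ V).prod ⊥

/-- The subgroup `{I} × O(U₂^⊥)` of `O₁(k+1) × O(n-k+2)`. -/
noncomputable def G₂ {n k : ℕ} (V : Submodule ℝ (Ambient n k)) : Subgroup (Pairs n k) :=
  Subgroup.prod ⊥ (O₂ V)

/-- The action of a pair of linear automorphisms on `W₁ ⊕ W₂`. -/
def act {n k : ℕ} (g : Pairs n k) (z : Ambient n k) : Ambient n k := (g.1 z.1, g.2 z.2)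

/-- The orbit of `z` under `G`. -/
def orbit {n k : ℕ} (G : Subgroup (Pairs n k)) (z : Ambient n k) : Set (Ambient n k) :=
  {w | ∃ g ∈ G, act g z = w}

/-- `G` leaves `S` invariant. -/
def LeavesInvariant {n k : ℕ} (G : Subgroup (Pairs n k)) (S : Set (Ambient n k)) : Prop :=
  ∀ g ∈ G, act g '' S = S

/-- `G` acts on the submanifold `S` with cohomogeneity `c`: the orbits of the points of `S` are
submanifolds, and the largest dimension of an orbit is `dim S - c`. -/
def HasCohomogeneity {n k : ℕ} (G : Subgroup (Pairs n k)) (S : Set (Ambient n k)) (c : ℕ) : Prop :=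
  ∃ d : ℕ, IsSubmanifold (d + c) S ∧
    (∃ z ∈ S, IsSubmanifold d (orbit G z)) ∧
    ∀ z ∈ S, ∃ e ≤ d, IsSubmanifold e (orbit G z)

/-- `z` is a regular point of the action of `G` on `S`: its orbit has the largest dimension among
the orbits of the points of `S`. -/
def IsRegularPoint {n k : ℕ} (G : Subgroup (Pairs n k)) (S : Set (Ambient n k))
    (z : Ambient n k) : Prop :=
  z ∈ S ∧ ∃ d : ℕ, IsSubmanifold d (orbit G z) ∧
    ∀ w ∈ S, ∀ e : ℕ, IsSubmanifold e (orbit G w) → e ≤ d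

/-- `N` is a round `d`-dimensional sphere of `W₂`: the points at distance `r > 0` from a centre `c`
in an affine subspace of dimension `d + 1` through `c`. -/
def IsRoundSphere {n k : ℕ} (d : ℕ) (N : Set (W₂ n k)) : Prop :=
  ∃ (c : W₂ n k) (r : ℝ) (L : Submodule ℝ (W₂ n k)),
    0 < r ∧ finrank ℝ L = d + 1 ∧ N = {y | y - c ∈ L ∧ ‖y - c‖ = r}

end UmbilicalRotation

open UmbilicalRotation

/-! A point `(x', y)` of `ℍ^k × {y}` lies in `V^⊥` together with `(x, y)` exactly when `x' - x ∈
U₁`. Elements of `O(U₁^⊥)` fix the `W₁`-components of `V`, so they preserve these leaves.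
Conversely, `x' - x` is space-like, and the reflection along it exchanges `x` and `x'` and fixes
`U₁^⊥`. Hence the orbits are the leaves (`orbit_G₁`); `orbit_G₂` is the same argument in `W₂`.

Substantiality enters twice, through `exists_mem_slice_ne`: `S` is not contained in the totally
geodesic hypersurface orthogonal to a space-like vector of `W₁` or `W₂`. Applied to vectors of `V`,
this makes both projections `V → W_i` injective, so the equations of a leaf are independent wherever
`x` (resp. `y`) is not orthogonal to `U_i`, and they give the expected dimension. Applied to a
vector of `U_i`, it helps to provide a point where this non-orthogonality holds. At every other
point the leaf is a singleton. The generic dimension is positive in the ranges considered, so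
singleton orbits are not regular.

On a leaf of the first kind, let `w ∈ U₁` be orthogonal to the tangent space `U₁ ∩ x^⊥`, with `⟨x,
w⟩ = -1`. A curve with velocity `u` has its acceleration `a` in `U₁`, with `⟨x, a⟩ = -⟨u, u⟩`, so `a
- ⟨u, u⟩ w` is tangent: the leaf is umbilical (`isUmbilical_leaf₁`). A leaf of the second kind is
the unit sphere cut by the affine space `y + U₂`, hence a round sphere (`exists_isRoundSphere`). -/

namespace UmbilicalRotation

/-! ### Derivatives of bilinear expressions. -/

section Bilinear

variable {E F : Type*} [NormedAddCommGroup E] [NormedSpace ℝ E] [FiniteDimensional ℝ E]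
  [NormedAddCommGroup F] [NormedSpace ℝ F]

theorem hasFDerivAt_quadratic (P : E →ₗ[ℝ] E →ₗ[ℝ] F) (hP : ∀ z w, P z w = P w z) (z : E) :
    HasFDerivAt (fun w => P w w) ((2 : ℝ) • P.toContinuousBilinearMap z) z := by
  have h := P.toContinuousBilinearMap.hasFDerivAt_of_bilinear (hasFDerivAt_id z)
    (hasFDerivAt_id z)
  refine h.congr_fderiv ?_
  ext w
  simp [hP w z, two_smul]

theorem contDiff_quadratic (P : E →ₗ[ℝ] E →ₗ[ℝ] F) : ContDiff ℝ ∞ (fun w => P w w) :=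
  P.toContinuousBilinearMap.contDiff.clm_apply contDiff_id

theorem hasDerivAt_bilin (P : E →ₗ[ℝ] E →ₗ[ℝ] F) {f g : ℝ → E} {f' g' : E} {t : ℝ}
    (hf : HasDerivAt f f' t) (hg : HasDerivAt g g' t) :
    HasDerivAt (fun s => P (f s) (g s)) (P f' (g t) + P (f t) g') t := by
  have h := (P.toContinuousBilinearMap.hasFDerivAt_of_bilinear hf.hasFDerivAt
    hg.hasFDerivAt).hasDerivAt
  refine h.congr_deriv ?_
  simp [add_comm]

end Bilinear

/-! ### Curves on quadrics and on affine subspaces. -/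

section Curves

variable {E F : Type*} [NormedAddCommGroup E] [NormedSpace ℝ E]
  [NormedAddCommGroup F] [NormedSpace ℝ F]

theorem eventually_hasDerivAt {γ : ℝ → E} (h : ContDiffAt ℝ ∞ γ 0) :
    ∀ᶠ t in 𝓝 (0 : ℝ), HasDerivAt γ (deriv γ t) t := by
  have h1 : ContDiffAt ℝ 1 γ 0 := h.of_le (by simp)
  filter_upwards [h1.eventually (by simp)] with t ht
  exact (ht.differentiableAt (by simp)).hasDerivAt

theorem hasDerivAt_deriv {γ : ℝ → E} (h : ContDiffAt ℝ ∞ γ 0) :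
    HasDerivAt (deriv γ) (deriv (deriv γ) 0) 0 := by
  have h1 : ContDiffAt ℝ 1 (deriv γ) 0 := by
    have h2 : ContDiffAt ℝ 1 (fderiv ℝ γ) 0 :=
      ContDiffAt.fderiv_right (m := 1) (n := ∞) h (by norm_cast)
    exact h2.clm_apply contDiffAt_const
  exact (h1.differentiableAt (by simp)).hasDerivAt

variable [FiniteDimensional ℝ E]

/-- The first two derivatives of a curve on a level set of a quadratic form. -/
theorem curve_quadratic {γ : ℝ → E} (h : ContDiffAt ℝ ∞ γ 0) (P : LinearMap.BilinForm ℝ E)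
    (hP : ∀ z w, P z w = P w z) {c : ℝ} (hc : ∀ᶠ t in 𝓝 (0 : ℝ), P (γ t) (γ t) = c) :
    P (γ 0) (deriv γ 0) = 0 ∧
      P (γ 0) (deriv (deriv γ) 0) = -P (deriv γ 0) (deriv γ 0) := by
  have key : ∀ᶠ t in 𝓝 (0 : ℝ), P (γ t) (deriv γ t) = 0 := by
    filter_upwards [hc.eventually_nhds, eventually_hasDerivAt h] with t ht ht'
    have h1 := hasDerivAt_bilin P ht' ht'
    have h2 : HasDerivAt (fun s => P (γ s) (γ s)) 0 t :=
      (hasDerivAt_const t c).congr_of_eventuallyEq ht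
    have h3 := h1.unique h2
    rw [hP (deriv γ t)] at h3
    linarith
  refine ⟨key.self_of_nhds, ?_⟩
  have h1 := hasDerivAt_bilin P (eventually_hasDerivAt h).self_of_nhds (hasDerivAt_deriv h)
  have h2 : HasDerivAt (fun s => P (γ s) (deriv γ s)) 0 0 :=
    (hasDerivAt_const 0 (0 : ℝ)).congr_of_eventuallyEq key
  linarith [h1.unique h2]

/-- The first two derivatives of a curve on a level set of a linear map. -/
theorem curve_linear {γ : ℝ → E} (h : ContDiffAt ℝ ∞ γ 0) (A : E →ₗ[ℝ] F)
    {c : F} (hc : ∀ᶠ t in 𝓝 (0 : ℝ), A (γ t) = c) :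
    A (deriv γ 0) = 0 ∧ A (deriv (deriv γ) 0) = 0 := by
  have key : ∀ᶠ t in 𝓝 (0 : ℝ), A (deriv γ t) = 0 := by
    filter_upwards [hc.eventually_nhds, eventually_hasDerivAt h] with t ht ht'
    have h1 := A.toContinuousLinearMap.hasFDerivAt.comp_hasDerivAt t ht'
    have h2 : HasDerivAt (fun s => A (γ s)) 0 t :=
      (hasDerivAt_const t c).congr_of_eventuallyEq ht
    exact h1.unique h2
  refine ⟨key.self_of_nhds, ?_⟩
  have h1 := A.toContinuousLinearMap.hasFDerivAt.comp_hasDerivAt 0 (hasDerivAt_deriv h)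
  have h2 : HasDerivAt (fun s => A (deriv γ s)) 0 0 :=
    (hasDerivAt_const 0 (0 : F)).congr_of_eventuallyEq key
  exact h1.unique h2

/-- On the level set of a quadratic form through `x` in the affine subspace `x + U`, every
direction `u ∈ U` orthogonal to `x` is the velocity of a smooth curve. The curve is the one traced
by the second intersection points with the lines through `x`. -/
theorem exists_curve_quadric {X : Type*} [NormedAddCommGroup X] [NormedSpace ℝ X]
    [FiniteDimensional ℝ X] (P : LinearMap.BilinForm ℝ X)
    (hP : ∀ z w, P z w = P w z) (U : Submodule ℝ X) {x u w : X} (hu : u ∈ U) (hw : w ∈ U)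
    (hxu : P x u = 0) (hxw : P x w ≠ 0) (hpos : u ≠ 0 → P u u ≠ 0) :
    ∃ α : ℝ → X, ContDiffAt ℝ ∞ α 0 ∧ α 0 = x ∧ HasDerivAt α u 0 ∧
      ∀ᶠ t in 𝓝 (0 : ℝ), α t - x ∈ U ∧ P (α t) (α t) = P x x := by
  by_cases hu0 : u = 0
  · subst hu0
    exact ⟨fun _ => x, contDiffAt_const, rfl, hasDerivAt_const _ _, by simp⟩
  have huu := hpos hu0
  -- The line through `x` with direction `q` meets the level set again at the parameter `-2 P(x, q)
  -- / P(q, q)`. This `c` turns it into `t * l t` with `l 0 = 1`, so that the curve starts with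
  -- velocity `u`.
  set c : ℝ := -(P u u) / (2 * P x w) with hc
  have hcw : P x (c • w) = -(P u u) / 2 := by
    simp only [map_smul, smul_eq_mul, hc]; field_simp
  set q : ℝ → X := fun t => u + t • (c • w) with hq
  have hqs : ContDiff ℝ ∞ q := by fun_prop
  have hD : ContDiff ℝ ∞ (fun t => P (q t) (q t)) := (contDiff_quadratic P).comp hqs
  have hD0 : P (q 0) (q 0) ≠ 0 := by simpa [hq] using huu
  set l : ℝ → ℝ := fun t => P u u / P (q t) (q t) with hl
  have hls : ContDiffAt ℝ ∞ l 0 := contDiffAt_const.div hD.contDiffAt hD0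
  have hsm : ContDiffAt ℝ ∞ (fun t => l t • q t) 0 := hls.smul hqs.contDiffAt
  refine ⟨fun t => x + t • (l t • q t), contDiffAt_const.add (contDiffAt_id.smul hsm), by simp,
    ?_, ?_⟩
  · have h1 := (hasDerivAt_id (0 : ℝ)).smul (hsm.differentiableAt (by simp)).hasDerivAt
    have h2 := h1.const_add x
    refine h2.congr_deriv ?_
    simp [hl, hq, huu]
  · filter_upwards [hD.continuous.continuousAt.eventually_ne hD0] with t ht
    refine ⟨?_, ?_⟩
    · have : q t ∈ U := U.add_mem hu (U.smul_mem _ (U.smul_mem _ hw))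
      simpa using U.smul_mem _ (U.smul_mem _ this)
    · have hxq : P x (q t) = -t * P u u / 2 := by
        have : P x (q t) = P x u + t * P x (c • w) := by simp [hq]
        rw [this, hxu, hcw]; ring
      have hlq : l t * P (q t) (q t) = P u u := div_mul_cancel₀ _ ht
      have : P (x + t • (l t • q t)) (x + t • (l t • q t)) =
          P x x + 2 * (t * l t) * P x (q t) + t ^ 2 * l t * (l t * P (q t) (q t)) := by
        simp only [map_add, map_smul, LinearMap.add_apply, LinearMap.smul_apply, smul_eq_mul,
          hP (q t) x]
        ring
      rw [this, hlq, hxq]; ring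

end Curves

/-! ### Submanifolds given by equations, and the dimension of a point. -/

section Submanifolds

variable {E : Type*} [NormedAddCommGroup E] [NormedSpace ℝ E] [FiniteDimensional ℝ E]

/-- A set cut out of an open set by quadratic and affine equations with independent
differentials is a submanifold. -/
theorem isSubmanifold_of_equations {F₁ F₂ : Type*} [AddCommGroup F₁] [Module ℝ F₁]
    [FiniteDimensional ℝ F₁] [AddCommGroup F₂] [Module ℝ F₂] [FiniteDimensional ℝ F₂]
    (Q : E →ₗ[ℝ] E →ₗ[ℝ] F₁) (hQ : ∀ z w, Q z w = Q w z) (A : E →ₗ[ℝ] F₂) (c : F₁) (a : F₂)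
    {O N : Set E} (hO : IsOpen O) (hN : N = {w ∈ O | Q w w = c ∧ A w = a})
    (hsurj : ∀ z ∈ N, ∀ r s, ∃ h, Q z h = r ∧ A h = s) {d : ℕ}
    (hd : d + (finrank ℝ F₁ + finrank ℝ F₂) = finrank ℝ E) : IsSubmanifold d N := by
  refine ⟨_, hd, fun z hz => ?_⟩
  have hfr : finrank ℝ (F₁ × F₂) =
      finrank ℝ (EuclideanSpace ℝ (Fin (finrank ℝ F₁ + finrank ℝ F₂))) := by simp
  let e := LinearEquiv.ofFinrankEq _ _ hfr
  let P : E →ₗ[ℝ] E →ₗ[ℝ] EuclideanSpace ℝ (Fin (finrank ℝ F₁ + finrank ℝ F₂)) :=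
    Q.compr₂ (e.toLinearMap ∘ₗ LinearMap.inl ℝ F₁ F₂)
  let A' := (e.toLinearMap ∘ₗ LinearMap.inr ℝ F₁ F₂ ∘ₗ A).toContinuousLinearMap
  let f := fun w => P w w + A' w - e (c, a)
  have hfe : ∀ w, f w = e ((Q w w, A w) - (c, a)) := by
    intro w
    simp only [f, P, A', map_sub]
    simp [← map_add]
  have hder : ∀ w, HasFDerivAt f ((2 : ℝ) • P.toContinuousBilinearMap w + A') w := fun w =>
    ((hasFDerivAt_quadratic P (fun z w => by simp [P, hQ z w]) w).add A'.hasFDerivAt).sub_const _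
  have hf0 : ∀ w, f w = 0 ↔ Q w w = c ∧ A w = a := by
    intro w
    rw [hfe, e.map_eq_zero_iff, sub_eq_zero, Prod.mk.injEq]
  refine ⟨O, f, hO, ?_, ?_, ?_, ?_⟩
  · rw [hN] at hz; exact hz.1
  · exact (((contDiff_quadratic P).add A'.contDiff).sub contDiff_const).contDiffOn
  · intro w hw y
    -- The differential of `w ↦ Q w w` is `2 Q w`; the factor `1 / 2` compensates for it.
    obtain ⟨h, h1, h2⟩ := hsurj w hw.1 ((1 / 2 : ℝ) • (e.symm y).1) (e.symm y).2
    refine ⟨h, ?_⟩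
    rw [(hder w).fderiv]
    have : ((2 : ℝ) • P.toContinuousBilinearMap w + A') h = e ((2 : ℝ) • Q w h, A h) := by
      change (2 : ℝ) • e (Q w h, 0) + e (0, A h) = _
      rw [← map_smul, ← map_add]
      simp
    rw [this, h1, h2, smul_smul]
    norm_num
  · ext w
    rw [hN]
    simp only [Set.mem_inter_iff, Set.mem_ofPred_eq, hf0]
    tauto

theorem isSubmanifold_singleton (z : E) : IsSubmanifold 0 ({z} : Set E) :=
  isSubmanifold_of_equations (F₁ := Fin 0 → ℝ) 0 (by simp) (LinearMap.id : E →ₗ[ℝ] E) 0 z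
    isOpen_univ (by ext; simp) (fun _ _ r s => ⟨s, Subsingleton.elim _ _, rfl⟩) (by simp)

/-- The implicit function parametrizes the zero set near `z` by the kernel of the differential. Here
it is locally constant, while its derivative is the inclusion of the kernel, so the kernel is zero
and `c = dim E`. -/
theorem IsSubmanifold.eq_zero_of_singleton {d : ℕ} {z : E} (h : IsSubmanifold d ({z} : Set E)) :
    d = 0 := by
  obtain ⟨c, hc, h⟩ := h
  obtain ⟨O, f, hO, hzO, hf, hs, hN⟩ := h z rfl
  have hsz := hs z ⟨rfl, hzO⟩
  have hcd : ContDiffAt ℝ ∞ f z := hf.contDiffAt (hO.mem_nhds hzO)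
  have hstr : HasStrictFDerivAt f (fderiv ℝ f z) z := hcd.hasStrictFDerivAt (by simp)
  have hr : (fderiv ℝ f z).range = ⊤ := LinearMap.range_eq_top.2 hsz
  have hfz : f z = 0 := by
    have : z ∈ ({z} : Set E) ∩ O := ⟨rfl, hzO⟩
    rw [hN] at this
    exact this.2
  have : CompleteSpace E := FiniteDimensional.complete ℝ E
  set φ := hstr.implicitFunction f (fderiv ℝ f z) hr (f z) with hφ
  have hφd : HasStrictFDerivAt φ (fderiv ℝ f z).ker.subtypeL 0 := hstr.to_implicitFunction hr
  have hφ0 : φ 0 = z := hstr.implicitFunction_apply_image hr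
  have hev : ∀ᶠ p in 𝓝 (0 : (fderiv ℝ f z).ker), f (φ p) = f z := by
    have h1 := hstr.map_implicitFunction_eq hr
    have h2 : Tendsto (fun p : (fderiv ℝ f z).ker => (f z, p)) (𝓝 0) (𝓝 (f z, 0)) :=
      (Continuous.prodMk_right (f z)).tendsto' _ _ rfl
    exact h2.eventually h1
  have hev2 : ∀ᶠ p in 𝓝 (0 : (fderiv ℝ f z).ker), φ p ∈ O := by
    apply hφd.continuousAt.eventually
    rw [hφ0]
    exact hO.mem_nhds hzO
  have hconst : φ =ᶠ[𝓝 0] fun _ => z := by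
    filter_upwards [hev, hev2] with p hp hp'
    have : φ p ∈ ({z} : Set E) ∩ O := by
      rw [hN]; exact ⟨hp', hp.trans hfz⟩
    exact this.1
  have hz : HasFDerivAt φ (0 : (fderiv ℝ f z).ker →L[ℝ] E) 0 :=
    (hasFDerivAt_const z _).congr_of_eventuallyEq hconst
  have h0 := hφd.hasFDerivAt.unique hz
  have hker : LinearMap.ker (fderiv ℝ f z : E →ₗ[ℝ] EuclideanSpace ℝ (Fin c)) = ⊥ := by
    rw [eq_bot_iff]
    intro v hv
    have := DFunLike.congr_fun h0 ⟨v, hv⟩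
    simpa using this
  have := (fderiv ℝ f z : E →ₗ[ℝ] EuclideanSpace ℝ (Fin c)).finrank_range_add_finrank_ker
  rw [hker, LinearMap.range_eq_top.2 hsz] at this
  simp at this
  omega

end Submanifolds

/-! ### Nondegenerate symmetric forms and reflections. -/

section Forms

variable {X G : Type*} [AddCommGroup X] [Module ℝ X] [AddCommGroup G] [Module ℝ G]

/-- Linear conditions given by independent vectors can be solved for a nondegenerate form. -/
theorem exists_bilin_eq [FiniteDimensional ℝ X] (P : LinearMap.BilinForm ℝ X) (hP : ∀ z w, P z w = P w z)
    (hnd : ∀ z, (∀ w, P z w = 0) → z = 0) (T : G →ₗ[ℝ] X) (hT : Function.Injective T)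
    (ξ : Dual ℝ G) : ∃ h, ∀ g, P (T g) h = ξ g := by
  have hker : P.ker = ⊥ := by
    rw [eq_bot_iff]
    intro z hz
    exact hnd z fun w => by rw [LinearMap.mem_ker.1 hz]; rfl
  have hsurj : Function.Surjective P :=
    (LinearMap.injective_iff_surjective_of_finrank_eq_finrank
      Subspace.dual_finrank_eq.symm).1 (LinearMap.ker_eq_bot.1 hker)
  -- `ξ` extends along the injection `T` to a functional on `X`, which nondegeneracy represents by a
  -- vector.
  obtain ⟨η, hη⟩ := LinearMap.dualMap_surjective_of_injective hT ξ
  obtain ⟨h, rfl⟩ := hsurj η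
  exact ⟨h, fun g => by rw [hP, ← hη]; rfl⟩

/-- Orthogonal projection onto a subspace on which the form is definite. -/
theorem exists_orthogonal_decomposition [FiniteDimensional ℝ X]
    (P : LinearMap.BilinForm ℝ X) (hP : ∀ z w, P z w = P w z)
    (T : Submodule ℝ X) (hT : ∀ u ∈ T, u ≠ 0 → 0 < P u u) (w : X) :
    ∃ τ ∈ T, ∀ u ∈ T, P u (w - τ) = 0 := by
  obtain ⟨h, hh⟩ := exists_bilin_eq (P.restrict T) (fun z w => hP z w)
    (fun z hz => by
      by_contra hne
      exact (hT z z.2 (by simpa using hne)).ne' (hz z)) LinearMap.id Function.injective_id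
    ((P w) ∘ₗ T.subtype)
  refine ⟨h, h.2, fun u hu => ?_⟩
  have := hh ⟨u, hu⟩
  simp only [LinearMap.id_coe, id_eq, LinearMap.BilinForm.restrict_apply,
    LinearMap.comp_apply, Submodule.subtype_apply] at this
  rw [map_sub, hP u w, sub_eq_zero]
  exact this.symm

/-- The reflection along a vector `w` that is not isotropic. -/
theorem exists_reflection (P : LinearMap.BilinForm ℝ X) (hP : ∀ z w, P z w = P w z) {w : X}
    (hw : P w w ≠ 0) :
    ∃ T : X ≃ₗ[ℝ] X, (∀ z, T z = z - (2 * P w z / P w w) • w) ∧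
      (∀ z, P w z = 0 → T z = z) ∧ (∀ z, T (T z) = z) ∧ ∀ z z', P (T z) (T z') = P z z' := by
  have hf : ((2 / P w w) • P w) w = 2 := by simp [hw]
  have hT : ∀ z, Module.reflection hf z = z - (2 * P w z / P w w) • w := fun z => by
    rw [Module.reflection_apply]
    congr 2
    simp only [LinearMap.smul_apply, smul_eq_mul]
    ring
  refine ⟨Module.reflection hf, hT, fun z hz => by simp [hT, hz],
    Module.involutive_reflection hf, fun z z' => ?_⟩
  simp only [hT, map_sub, map_smul, LinearMap.sub_apply, LinearMap.smul_apply, smul_eq_mul,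
    hP _ w]
  field_simp
  ring

/-- The reflection along the difference of two vectors of the same length exchanges them. -/
theorem reflection_apply_of_eq (P : LinearMap.BilinForm ℝ X) (hP : ∀ z w, P z w = P w z)
    {x x' : X} (h : P x x = P x' x') (hne : P (x' - x) (x' - x) ≠ 0) :
    x - (2 * P (x' - x) x / P (x' - x) (x' - x)) • (x' - x) = x' := by
  have : 2 * P (x' - x) x = - P (x' - x) (x' - x) := by
    simp only [map_sub, LinearMap.sub_apply, hP x' x]
    linarith
  rw [this, neg_div, div_self hne]
  simp

end Forms

/-! ### Geometry of `ℍ^k` and its reflections. -/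

section Lorentz

variable {k : ℕ}

theorem lorentzForm_apply (x y : W₁ k) :
    lorentzForm k x y = -(x 0 * y 0) + ∑ i : Fin k, x i.succ * y i.succ := rfl

theorem lorentzForm_comm (x y : W₁ k) : lorentzForm k x y = lorentzForm k y x := by
  simp only [lorentzForm_apply, mul_comm]

theorem lorentzForm_nondegenerate (x : W₁ k) (h : ∀ y, lorentzForm k x y = 0) : x = 0 := by
  ext j
  refine Fin.cases ?_ (fun i => ?_) j
  · simpa [lorentzForm_apply] using h (EuclideanSpace.single 0 1)
  · simpa [lorentzForm_apply, Pi.single_apply] using h (EuclideanSpace.single i.succ 1)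

/-- Cauchy–Schwarz for the space components: adding `x 0 * y 0` removes the time part of the form.
-/
theorem sum_mul_sq_le (x y : W₁ k) :
    (lorentzForm k x y + x 0 * y 0) ^ 2 ≤
      (lorentzForm k x x + x 0 ^ 2) * (lorentzForm k y y + y 0 ^ 2) := by
  have := Finset.sum_mul_sq_le_sq_mul_sq Finset.univ (fun i : Fin k => x i.succ)
    (fun i => y i.succ)
  simpa [lorentzForm_apply, ← pow_two] using this

theorem sum_sq_nonneg (x : W₁ k) : 0 ≤ lorentzForm k x x + x 0 ^ 2 := by
  have : lorentzForm k x x + x 0 ^ 2 = ∑ i : Fin k, x i.succ ^ 2 := by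
    simp [lorentzForm_apply, ← pow_two]
  rw [this]
  positivity

/-- The orthogonal complement of a point of `ℍ^k` is space-like. -/
theorem lorentzForm_pos_of_orthogonal {x u : W₁ k} (hx : x ∈ hyperbolicSpace k)
    (hxu : lorentzForm k x u = 0) (hu : u ≠ 0) : 0 < lorentzForm k u u := by
  by_contra! hle
  have h1 := sum_mul_sq_le x u
  have h2 := sum_sq_nonneg u
  rw [hx.1, hxu] at h1
  have hx0 : 1 ≤ x 0 ^ 2 := by nlinarith [sum_sq_nonneg x, hx.1]
  -- Cauchy–Schwarz gives `x₀² u₀² ≤ (x₀² - 1)(⟨u, u⟩ + u₀²)`, and the right side is at most `(x₀² -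
  -- 1) u₀²` when `⟨u, u⟩ ≤ 0`.
  have hu0 : u 0 ^ 2 ≤ 0 := by
    nlinarith [mul_le_mul_of_nonneg_left hle (by linarith : (0 : ℝ) ≤ -1 + x 0 ^ 2)]
  have hu0' : u 0 = 0 := by nlinarith
  have hsum : ∑ i : Fin k, u i.succ ^ 2 = 0 := by
    have : lorentzForm k u u + u 0 ^ 2 = ∑ i : Fin k, u i.succ ^ 2 := by
      simp [lorentzForm_apply, ← pow_two]
    linarith
  apply hu
  ext j
  refine Fin.cases hu0' (fun i => ?_) j
  simpa using (Finset.sum_eq_zero_iff_of_nonneg (fun i _ => sq_nonneg _)).1 hsum i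
    (Finset.mem_univ i)

/-- If `⟨x, y⟩ ≥ 0`, Cauchy–Schwarz would give `x₀² y₀² ≤ (x₀² - 1)(y₀² - 1)`, impossible for `x₀²,
y₀² ≥ 1`. -/
theorem lorentzForm_neg {x y : W₁ k} (hx : x ∈ hyperbolicSpace k)
    (hy : y ∈ hyperbolicSpace k) : lorentzForm k x y < 0 := by
  by_contra! hle
  have h1 := sum_mul_sq_le x y
  have hxy := mul_pos hx.2 hy.2
  rw [hx.1, hy.1] at h1
  have hx0 : 0 ≤ -1 + x 0 ^ 2 := hx.1 ▸ sum_sq_nonneg x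
  nlinarith [mul_nonneg hle hxy.le, sq_nonneg (lorentzForm k x y), hy.1 ▸ sum_sq_nonneg y]

/-- The difference of two points of `ℍ^k` is space-like. -/
theorem lorentzForm_sub_pos {x y : W₁ k} (hx : x ∈ hyperbolicSpace k)
    (hy : y ∈ hyperbolicSpace k) (hne : x ≠ y) :
    0 < lorentzForm k (y - x) (y - x) := by
  have hneg := lorentzForm_neg hx hy
  set c := lorentzForm k x y with hc
  have hyx : lorentzForm k y x = c := lorentzForm_comm y x
  -- The component of `y` orthogonal to `x` is space-like or zero; its square `c² - 1` together with
  -- `c < 0` gives `c < -1` unless `y = x`.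
  set u := y + c • x with hu
  have hxu : lorentzForm k x u = 0 := by
    simp only [hu, map_add, map_smul, smul_eq_mul, hx.1, ← hc]
    ring
  have huu : lorentzForm k u u = c ^ 2 - 1 := by
    simp only [hu, map_add, map_smul, smul_eq_mul, LinearMap.add_apply, LinearMap.smul_apply,
      hx.1, hy.1, ← hc, hyx]
    ring
  have hval : lorentzForm k (y - x) (y - x) = -2 - 2 * c := by
    simp only [map_sub, LinearMap.sub_apply, hx.1, hy.1, ← hc, hyx]
    ring
  rw [hval]
  by_cases hu0 : u = 0
  · exfalso
    have hc1 : c ^ 2 - 1 = 0 := by rw [← huu, hu0]; simp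
    have hc' : c = -1 := by nlinarith
    apply hne
    rw [hu, hc'] at hu0
    simpa [← sub_eq_add_neg, sub_eq_zero, eq_comm] using hu0
  · have := lorentzForm_pos_of_orthogonal hx hxu hu0
    nlinarith

/-- The reflection along a space-like vector preserves `ℍ^k`. -/
theorem reflection_mem_hyperbolicSpace {w z : W₁ k} (hw : 0 < lorentzForm k w w)
    (hz : z ∈ hyperbolicSpace k)
    (hT : lorentzForm k (z - (2 * lorentzForm k w z / lorentzForm k w w) • w)
      (z - (2 * lorentzForm k w z / lorentzForm k w w) • w) = lorentzForm k z z) :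
    z - (2 * lorentzForm k w z / lorentzForm k w w) • w ∈ hyperbolicSpace k := by
  set y := z - (2 * lorentzForm k w z / lorentzForm k w w) • w with hy
  have hyy : lorentzForm k y y = -1 := hT.trans hz.1
  refine ⟨hyy, ?_⟩
  by_contra! hle
  have hy0 : y 0 ≠ 0 := by
    intro h0
    have := sum_sq_nonneg y
    rw [hyy, h0] at this
    norm_num at this
  -- If the image lay on the lower sheet, its negative would be in `ℍ^k` and have negative product
  -- with `z`; the product is at least `1`.
  have hmem : -y ∈ hyperbolicSpace k := ⟨by simpa using hyy, by
    simpa using lt_of_le_of_ne hle hy0⟩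
  have h1 := lorentzForm_neg hz hmem
  have h2 : lorentzForm k z (-y) = 1 + 2 * lorentzForm k w z ^ 2 / lorentzForm k w w := by
    simp only [hy, map_neg, map_sub, map_smul, smul_eq_mul, hz.1, lorentzForm_comm z w]
    ring
  have : 0 ≤ 2 * lorentzForm k w z ^ 2 / lorentzForm k w w := by positivity
  linarith

/-- Two points of `ℍ^k` are exchanged by an element of `O₁(k+1)` that fixes the orthogonal
complement of their difference. -/
theorem exists_mem_lorentzGroup {x x' : W₁ k} (hx : x ∈ hyperbolicSpace k)
    (hx' : x' ∈ hyperbolicSpace k) :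
    ∃ T ∈ lorentzGroup k, T x = x' ∧ ∀ z, lorentzForm k (x' - x) z = 0 → T z = z := by
  by_cases hne : x = x'
  · exact ⟨1, one_mem _, hne, fun _ _ => rfl⟩
  have hw := lorentzForm_sub_pos hx hx' hne
  obtain ⟨T, hT, hfix, hinv, hiso⟩ := exists_reflection (lorentzForm k) lorentzForm_comm hw.ne'
  have hpres : ∀ z ∈ hyperbolicSpace k, T z ∈ hyperbolicSpace k := fun z hz => by
    have := hiso z z
    rw [hT] at this ⊢
    exact reflection_mem_hyperbolicSpace hw hz this
  refine ⟨T, ⟨hiso, fun z => ⟨fun h => ?_, hpres z⟩⟩, ?_, hfix⟩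
  · rw [← hinv z]; exact hpres _ h
  · rw [hT]
    exact reflection_apply_of_eq _ lorentzForm_comm (hx.1.trans hx'.1.symm) hw.ne'

/-- A curve in `ℍ^k ∩ (x + U)` with given velocity. -/
theorem exists_curve_hyperbolicSpace (U : Submodule ℝ (W₁ k)) {x u w : W₁ k}
    (hx : x ∈ hyperbolicSpace k) (hu : u ∈ U) (hw : w ∈ U) (hxu : lorentzForm k x u = 0)
    (hxw : lorentzForm k x w ≠ 0) :
    ∃ α : ℝ → W₁ k, ContDiffAt ℝ ∞ α 0 ∧ α 0 = x ∧ HasDerivAt α u 0 ∧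
      ∀ᶠ t in 𝓝 (0 : ℝ), α t - x ∈ U ∧ α t ∈ hyperbolicSpace k := by
  obtain ⟨α, hs, h0, hd, hev⟩ := exists_curve_quadric (lorentzForm k) lorentzForm_comm U hu hw hxu
    hxw (fun h => (lorentzForm_pos_of_orthogonal hx hxu h).ne')
  refine ⟨α, hs, h0, hd, ?_⟩
  have hc : ContinuousAt (fun t => (α t) 0) 0 :=
    (EuclideanSpace.proj (0 : Fin (k + 1)) : W₁ k →L[ℝ] ℝ).continuous.continuousAt.comp
      hs.continuousAt
  have hpos : ∀ᶠ t in 𝓝 (0 : ℝ), 0 < (α t) 0 := hc.eventually_const_lt (by simpa [h0] using hx.2)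
  filter_upwards [hev, hpos] with t ht ht'
  exact ⟨ht.1, ht.2.trans hx.1, ht'⟩

end Lorentz

/-! ### The unit sphere and its reflections. -/

section Euclidean

variable {n k : ℕ}

theorem innerₗ_comm (z w : W₂ n k) : innerₗ (W₂ n k) z w = innerₗ (W₂ n k) w z :=
  real_inner_comm w z

theorem exists_mem_orthogonalGroup {y y' : W₂ n k} (hy : y ∈ unitSphere n k)
    (hy' : y' ∈ unitSphere n k) :
    ∃ T ∈ orthogonalGroup n k, T y = y' ∧ ∀ z, inner ℝ (y' - y) z = 0 → T z = z := by
  by_cases hne : y = y'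
  · exact ⟨1, one_mem _, hne, fun _ _ => rfl⟩
  have hw : innerₗ (W₂ n k) (y' - y) (y' - y) ≠ 0 := by
    rw [innerₗ_apply_apply, inner_self_ne_zero, sub_ne_zero]
    exact Ne.symm hne
  obtain ⟨T, hT, hfix, -, hiso⟩ := exists_reflection (innerₗ (W₂ n k)) innerₗ_comm hw
  refine ⟨T, hiso, ?_, hfix⟩
  rw [hT]
  refine reflection_apply_of_eq _ innerₗ_comm ?_ hw
  have h1 : ‖y‖ = 1 := hy
  have h2 : ‖y'‖ = 1 := hy'
  simp [h1, h2]

theorem inner_self_of_mem {y : W₂ n k} (hy : y ∈ unitSphere n k) : inner ℝ y y = 1 := by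
  rw [real_inner_self_eq_norm_sq, show ‖y‖ = 1 from hy]; norm_num

theorem mem_unitSphere_iff {y : W₂ n k} : y ∈ unitSphere n k ↔ inner ℝ y y = 1 := by
  refine ⟨inner_self_of_mem, fun h => ?_⟩
  rw [real_inner_self_eq_norm_sq] at h
  exact (pow_eq_one_iff_of_nonneg (norm_nonneg y) two_ne_zero).1 h

/-- A curve in the unit sphere of `y + U` with given velocity. -/
theorem exists_curve_unitSphere (U : Submodule ℝ (W₂ n k)) {y u w : W₂ n k}
    (hy : y ∈ unitSphere n k) (hu : u ∈ U) (hw : w ∈ U) (hyu : inner ℝ y u = 0)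
    (hyw : inner ℝ y w ≠ 0) :
    ∃ α : ℝ → W₂ n k, ContDiffAt ℝ ∞ α 0 ∧ α 0 = y ∧ HasDerivAt α u 0 ∧
      ∀ᶠ t in 𝓝 (0 : ℝ), α t - y ∈ U ∧ α t ∈ unitSphere n k := by
  obtain ⟨α, hs, h0, hd, hev⟩ := exists_curve_quadric (innerₗ (W₂ n k))
    innerₗ_comm U hu hw hyu hyw (fun h => by simpa using h)
  refine ⟨α, hs, h0, hd, ?_⟩
  filter_upwards [hev] with t ht
  exact ⟨ht.1, mem_unitSphere_iff.2 (ht.2.trans (inner_self_of_mem hy))⟩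

end Euclidean

variable {n k : ℕ} {V : Submodule ℝ (Ambient n k)}

/-! ### The ambient form, `V^⊥`, and the smoothness of `S`. -/

section Basic

theorem ambientForm_apply (z w : Ambient n k) :
    ambientForm n k z w = lorentzForm k z.1 w.1 + inner ℝ z.2 w.2 := rfl

theorem ambientForm_comm (z w : Ambient n k) : ambientForm n k z w = ambientForm n k w z := by
  rw [ambientForm_apply, ambientForm_apply, lorentzForm_comm, real_inner_comm]

theorem ambientForm_nondegenerate (z : Ambient n k) (h : ∀ w, ambientForm n k z w = 0) :
    z = 0 := by
  refine Prod.ext (lorentzForm_nondegenerate _ fun a => ?_) ?_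
  · simpa [ambientForm_apply] using h (a, 0)
  · simpa [ambientForm_apply] using h (0, z.2)

theorem finrank_ambient : finrank ℝ (Ambient n k) = k + 1 + (n + 2 - k) := by simp

theorem mem_perp {z : Ambient n k} : z ∈ perp V ↔ ∀ v ∈ V, ambientForm n k v z = 0 := Iff.rfl

theorem mem_U₁ {u : W₁ k} : u ∈ U₁ V ↔ ∀ v ∈ V, lorentzForm k v.1 u = 0 := by
  change (∀ v ∈ V, ambientForm n k v (u, 0) = 0) ↔ _
  simp [ambientForm_apply]

theorem mem_U₂ {u : W₂ n k} : u ∈ U₂ V ↔ ∀ v ∈ V, inner ℝ v.2 u = 0 := by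
  change (∀ v ∈ V, ambientForm n k v (0, u) = 0) ↔ _
  simp [ambientForm_apply]

/-- The evaluations of `⟨·, z⟩` on `V`. -/
noncomputable def pairing (V : Submodule ℝ (Ambient n k)) : Ambient n k →ₗ[ℝ] Dual ℝ V :=
  V.subtype.dualMap ∘ₗ (ambientForm n k).flip

theorem pairing_apply (z : Ambient n k) (v : V) : pairing V z v = ambientForm n k v z := rfl

theorem pairing_eq_zero {z : Ambient n k} : pairing V z = 0 ↔ z ∈ perp V := by
  rw [mem_perp, LinearMap.ext_iff]
  simp [pairing_apply]

theorem mem_slice {x : W₁ k} {y : W₂ n k} :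
    (x, y) ∈ slice V ↔ (x ∈ hyperbolicSpace k ∧ y ∈ unitSphere n k) ∧ (x, y) ∈ perp V := Iff.rfl

theorem isOpen_pos_time : IsOpen {z : Ambient n k | 0 < z.1 0} :=
  isOpen_lt continuous_const
    ((EuclideanSpace.proj (0 : Fin (k + 1)) : W₁ k →L[ℝ] ℝ).continuous.comp continuous_fst)

/-- The two summands of the inner product of `W₁ ⊕ W₂`. -/
noncomputable def splitForm (n k : ℕ) : Ambient n k →ₗ[ℝ] Ambient n k →ₗ[ℝ] ℝ × ℝ :=
  LinearMap.mk₂ ℝ (fun z w => (lorentzForm k z.1 w.1, inner ℝ z.2 w.2))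
    (by intro x x' y; simp [inner_add_left])
    (by intro c x y; simp [inner_smul_left])
    (by intro x y y'; simp [inner_add_right])
    (by intro c x y; simp [inner_smul_right])

theorem splitForm_apply (z w : Ambient n k) :
    splitForm n k z w = (lorentzForm k z.1 w.1, inner ℝ z.2 w.2) := rfl

theorem splitForm_comm (z w : Ambient n k) : splitForm n k z w = splitForm n k w z := by
  rw [splitForm_apply, splitForm_apply, lorentzForm_comm, real_inner_comm]

/-- The intersection of `ℍ^k × 𝕊^{n-k+1}` with the orthogonal complement of a space-like
subspace is transversal. -/
theorem isSubmanifold_slice (hV : IsSpacelike (ambientForm n k) V) {d : ℕ}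
    (hd : d + (2 + finrank ℝ V) = finrank ℝ (Ambient n k)) : IsSubmanifold d (slice V) := by
  refine isSubmanifold_of_equations (splitForm n k) splitForm_comm (pairing V) (-1, 1) 0
    isOpen_pos_time ?_ ?_ (by simpa using hd)
  · ext ⟨x, y⟩
    simp only [mem_slice, Set.mem_ofPred_eq, splitForm_apply, Prod.mk.injEq, pairing_eq_zero,
      mem_unitSphere_iff]
    change ((_ ∧ _) ∧ _) ∧ _ ↔ _
    tauto
  · rintro ⟨x, y⟩ ⟨⟨hx, hy⟩, hp⟩ r s
    replace hx : x ∈ hyperbolicSpace k := hx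
    replace hy : inner ℝ y y = (1 : ℝ) := inner_self_of_mem hy
    let T : ℝ × ℝ × V →ₗ[ℝ] Ambient n k :=
      (LinearMap.toSpanSingleton ℝ _ ((x, 0) : Ambient n k)).coprod
        ((LinearMap.toSpanSingleton ℝ _ ((0, y) : Ambient n k)).coprod V.subtype)
    have hTa : ∀ a b v, T (a, b, v) = (a • x, b • y) + (v : Ambient n k) := by
      intro a b v
      simp [T, ← add_assoc]
    have hT : Function.Injective T := by
      rw [← LinearMap.ker_eq_bot, eq_bot_iff]
      rintro ⟨a, b, v, hv⟩ h0
      rw [LinearMap.mem_ker, hTa] at h0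
      -- Pairing a relation `(a x, b y) + v = 0` with `(x, y) ∈ V^⊥` gives `a = b`. Then `⟨v, v⟩ =
      -- -a² + b² = 0`, and `v = 0` since `V` is space-like.
      have h1 : ambientForm n k (x, y) ((a • x, b • y) + v) = 0 := by
        simp only [h0, map_zero]
      have hvp : ambientForm n k (x, y) v = 0 := by rw [ambientForm_comm]; exact hp v hv
      rw [map_add, hvp, ambientForm_apply] at h1
      simp only [map_smul, inner_smul_right, hx.1, hy, smul_eq_mul] at h1
      have hab : a = b := by linarith
      have hve : v = -(a • x, b • y) := (neg_eq_of_add_eq_zero_right h0).symm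
      have hvv : ambientForm n k v v = 0 := by
        have hyb : inner ℝ (b • y) (b • y) = b * b := by
          rw [inner_smul_left, inner_smul_right, hy]
          simp
        rw [hve, map_neg, map_neg, LinearMap.neg_apply, neg_neg, ambientForm_apply, hyb]
        simp [hx.1, hab]
      have hv0 : v = 0 := by
        by_contra hne
        exact (hV v hv hne).ne' hvv
      rw [hv0] at hve
      have hax : a • x = 0 := by simpa using congrArg Prod.fst hve.symm
      have ha : a = 0 := by
        have := congrArg (lorentzForm k x) hax
        simpa [hx.1] using this
      subst hab; subst ha; subst hv0
      simp
    obtain ⟨h, hh⟩ := exists_bilin_eq (ambientForm n k) ambientForm_comm ambientForm_nondegenerate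
      T hT ((r.1 • LinearMap.id).coprod ((r.2 • LinearMap.id).coprod s))
    refine ⟨h, ?_, ?_⟩
    · have h1 := hh (1, 0, 0)
      have h2 := hh (0, 1, 0)
      simp only [hTa] at h1 h2
      refine Prod.ext ?_ ?_
      · simpa [ambientForm_apply, splitForm_apply] using h1
      · simpa [ambientForm_apply, splitForm_apply] using h2
    · ext v
      have h3 := hh (0, 0, v)
      simp only [hTa] at h3
      simpa [pairing_apply, ← Prod.zero_eq_mk] using h3

end Basic

/-! ### Tangent vectors of the product and of subsets of it. -/

section Tangent

/-- Vectors tangent to `ℍ^k × 𝕊^{n-k+1}` are orthogonal to both components of the base point. -/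
theorem tangent_productSpace {x : W₁ k} {y : W₂ n k} {η : Ambient n k}
    (h : η ∈ tangentVectors (productSpace n k) (x, y)) :
    lorentzForm k x η.1 = 0 ∧ inner ℝ y η.2 = 0 := by
  obtain ⟨γ, ⟨hs, h0, hev⟩, rfl⟩ := h
  refine ⟨?_, ?_⟩
  · have := (curve_quadratic hs ((lorentzForm k).compl₁₂ (LinearMap.fst ℝ _ _)
      (LinearMap.fst ℝ _ (W₂ n k))) (fun _ _ => lorentzForm_comm _ _) (c := -1)
      (hev.mono fun t ht => ht.1.1)).1
    simpa [h0] using this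
  · have := (curve_quadratic hs ((innerₗ (W₂ n k)).compl₁₂ (LinearMap.snd ℝ (W₁ k) _)
      (LinearMap.snd ℝ (W₁ k) _)) (fun _ _ => innerₗ_comm _ _) (c := 1)
      (hev.mono fun t ht => inner_self_of_mem ht.2)).1
    simpa [h0] using this

theorem mem_tangentVectors_left {N : Set (Ambient n k)} {x : W₁ k} {y : W₂ n k}
    (U : Submodule ℝ (W₁ k)) (hN : ∀ x' ∈ hyperbolicSpace k, x' - x ∈ U → (x', y) ∈ N)
    {u w : W₁ k} (hx : x ∈ hyperbolicSpace k) (hu : u ∈ U) (hw : w ∈ U)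
    (hxu : lorentzForm k x u = 0) (hxw : lorentzForm k x w ≠ 0) :
    ((u, 0) : Ambient n k) ∈ tangentVectors N (x, y) := by
  obtain ⟨α, hs, h0, hd, hev⟩ := exists_curve_hyperbolicSpace U hx hu hw hxu hxw
  refine ⟨fun t => (α t, y), ⟨hs.prodMk contDiffAt_const, Prod.ext h0 rfl, ?_⟩, ?_⟩
  · filter_upwards [hev] with t ht using hN _ ht.2 ht.1
  · exact (hd.prodMk (hasDerivAt_const _ _)).deriv

theorem mem_tangentVectors_right {N : Set (Ambient n k)} {x : W₁ k} {y : W₂ n k}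
    (U : Submodule ℝ (W₂ n k)) (hN : ∀ y' ∈ unitSphere n k, y' - y ∈ U → (x, y') ∈ N)
    {u w : W₂ n k} (hy : y ∈ unitSphere n k) (hu : u ∈ U) (hw : w ∈ U)
    (hyu : inner ℝ y u = 0) (hyw : inner ℝ y w ≠ 0) :
    ((0, u) : Ambient n k) ∈ tangentVectors N (x, y) := by
  obtain ⟨α, hs, h0, hd, hev⟩ := exists_curve_unitSphere U hy hu hw hyu hyw
  refine ⟨fun t => (x, α t), ⟨contDiffAt_const.prodMk hs, Prod.ext rfl h0, ?_⟩, ?_⟩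
  · filter_upwards [hev] with t ht using hN _ ht.2 ht.1
  · exact ((hasDerivAt_const _ _).prodMk hd).deriv

end Tangent

/-! ### Consequences of substantiality. -/

section Substantial

theorem mem_perp_span {u z : Ambient n k} :
    z ∈ perp (Submodule.span ℝ {u}) ↔ ambientForm n k u z = 0 := by
  rw [mem_perp]
  refine ⟨fun h => h u (Submodule.mem_span_singleton_self u), fun h v hv => ?_⟩
  obtain ⟨c, rfl⟩ := Submodule.mem_span_singleton.1 hv
  simp [h]

/-- The hypersurface of `ℍ^k × 𝕊^{n-k+1}` orthogonal to a space-like vector of one of the two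
factors is totally geodesic. -/
theorem isTotallyGeodesic_slice_span (hkn : k ≤ n + 1) {u : Ambient n k}
    (hu : 0 < ambientForm n k u u) (h0 : u.1 = 0 ∨ u.2 = 0) :
    IsTotallyGeodesicSubmanifold (ambientForm n k) (productSpace n k) n
      (slice (Submodule.span ℝ {u})) := by
  have hu0 : u ≠ 0 := by rintro rfl; simp at hu
  refine ⟨isSubmanifold_slice ?_ ?_, Set.inter_subset_left, ?_⟩
  · intro v hv hv0
    obtain ⟨c, rfl⟩ := Submodule.mem_span_singleton.1 hv
    have hc : c ≠ 0 := by rintro rfl; simp at hv0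
    simp only [map_smul, LinearMap.smul_apply, smul_eq_mul]
    have := mul_self_pos.2 hc
    nlinarith
  · rw [finrank_span_singleton hu0, finrank_ambient]
    omega
  -- As `u` lies in one factor, orthogonality to `u` holds in each component separately. Projections
  -- to `x^⊥` and `y^⊥` therefore stay orthogonal to `u`.
  have hsplit : ∀ z, ambientForm n k u z = 0 →
      lorentzForm k u.1 z.1 = 0 ∧ inner ℝ u.2 z.2 = 0 := by
    intro z hz
    rw [ambientForm_apply] at hz
    rcases h0 with h | h <;> simp_all
  rintro ⟨x, y⟩ ⟨⟨hx, hy⟩, hp⟩ γ ⟨hs, hγ0, hev⟩ η ⟨hηM, hηN⟩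
  replace hx : x ∈ hyperbolicSpace k := hx
  replace hy : y ∈ unitSphere n k := hy
  have hyy := inner_self_of_mem hy
  obtain ⟨hxp, hyp⟩ := hsplit _ (mem_perp_span.1 hp)
  obtain ⟨hη1, hη2⟩ := tangent_productSpace hηM
  have hacc := (curve_linear hs (ambientForm n k u) (c := 0)
    (hev.mono fun t ht => mem_perp_span.1 ht.2)).2
  set a := deriv (deriv γ) 0
  obtain ⟨ha1, ha2⟩ := hsplit _ hacc
  -- The part of the acceleration orthogonal to `x` is tangent to the slice, hence orthogonal to
  -- `η`; the remaining multiple of `x` is orthogonal to `η` because `η` is tangent to the product.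
  -- The same holds for `y`.
  have h1 : lorentzForm k (a.1 + lorentzForm k x a.1 • x) η.1 = 0 := by
    have := hηN _ (mem_tangentVectors_left (N := slice (Submodule.span ℝ {u})) (x := x) (y := y)
      (LinearMap.ker (lorentzForm k u.1)) (w := x)
      (u := a.1 + lorentzForm k x a.1 • x)
      (fun x' hx' hd => ⟨⟨hx', hy⟩, mem_perp_span.2 (by
        have : lorentzForm k u.1 x' = 0 := by
          have := LinearMap.mem_ker.1 hd
          rw [map_sub, hxp] at this
          simpa using this
        rw [ambientForm_apply, this, hyp, add_zero])⟩)
      hx (by simp [ha1, hxp]) (by simpa using hxp) (by simp [hx.1]) (by simp [hx.1]))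
    simpa [ambientForm_apply] using this
  have h2 : inner ℝ (a.2 - inner ℝ y a.2 • y) η.2 = 0 := by
    have := hηN _ (mem_tangentVectors_right (N := slice (Submodule.span ℝ {u})) (x := x) (y := y)
      (LinearMap.ker (innerₗ (W₂ n k) u.2)) (w := y)
      (u := a.2 - inner ℝ y a.2 • y)
      (fun y' hy' hd => ⟨⟨hx, hy'⟩, mem_perp_span.2 (by
        have : inner ℝ u.2 y' = 0 := by
          have := LinearMap.mem_ker.1 hd
          rw [innerₗ_apply_apply, inner_sub_right, hyp] at this
          simpa using this
        rw [ambientForm_apply, this, hxp, add_zero])⟩)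
      hy (by simp [ha2, hyp, inner_sub_right, inner_smul_right])
      (by simpa using hyp) (by rw [inner_sub_right, inner_smul_right, hyy, mul_one, sub_self])
      (by rw [hyy]; exact one_ne_zero))
    simpa [ambientForm_apply] using this
  rw [ambientForm_apply]
  simp only [map_add, map_smul, LinearMap.add_apply, LinearMap.smul_apply, hη1] at h1
  rw [inner_sub_left, inner_smul_left, hη2] at h2
  simp only [smul_zero, mul_zero, add_zero, sub_zero] at h1 h2
  rw [h1, h2, add_zero]

/-- The empty set is vacuously a totally geodesic submanifold of dimension `0`. -/
theorem slice_nonempty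
    (hS : IsSubstantial (ambientForm n k) (productSpace n k) (n + 1) (slice V)) : (slice V).Nonempty := by
  by_contra h
  rw [Set.not_nonempty_iff_eq_empty] at h
  exact hS ⟨0, by omega, ∅, ⟨⟨_, zero_add _, by simp⟩, by simp, by simp⟩, h.subset⟩

theorem exists_mem_slice_ne (hkn : k ≤ n + 1)
    (hS : IsSubstantial (ambientForm n k) (productSpace n k) (n + 1) (slice V))
    {u : Ambient n k} (hu : 0 < ambientForm n k u u)
    (h0 : u.1 = 0 ∨ u.2 = 0) :
    ∃ z ∈ slice V, ambientForm n k u z ≠ 0 := by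
  by_contra! h
  exact hS ⟨n, by omega, _, isTotallyGeodesic_slice_span hkn hu h0,
    fun z hz => ⟨hz.1, mem_perp_span.2 (h z hz)⟩⟩

/-- Otherwise `S`, being orthogonal to `v`, would lie in a totally geodesic hypersurface. This gives
the injectivity of both projections of `V`. -/
theorem eq_zero_of_component_eq_zero (hkn : k ≤ n + 1)
    (hS : IsSubstantial (ambientForm n k) (productSpace n k) (n + 1) (slice V))
    (hV : IsSpacelike (ambientForm n k) V) {v : Ambient n k}
    (hv : v ∈ V) (h0 : v.1 = 0 ∨ v.2 = 0) : v = 0 := by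
  by_contra hne
  obtain ⟨z, hz, hz'⟩ := exists_mem_slice_ne hkn hS (hV v hv hne) h0
  exact hz' (hz.2 v hv)

end Substantial

/-! ### Invariance of `S` and description of the orbits. -/

section Groups

theorem leavesInvariant_of_forall {G : Subgroup (Pairs n k)} {S : Set (Ambient n k)}
    (h : ∀ g ∈ G, ∀ z ∈ S, act g z ∈ S) : LeavesInvariant G S := by
  refine fun g hg => Set.Subset.antisymm (Set.image_subset_iff.2 (h g hg)) fun z hz => ?_
  exact ⟨act g⁻¹ z, h _ (inv_mem hg) z hz,
    Prod.ext (g.1.apply_symm_apply z.1) (g.2.apply_symm_apply z.2)⟩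

theorem mem_G₁ {g : Pairs n k} : g ∈ G₁ V ↔ g.1 ∈ O₁ V ∧ g.2 = 1 := by
  rw [G₁, Subgroup.mem_prod, Subgroup.mem_bot]

theorem mem_G₂ {g : Pairs n k} : g ∈ G₂ V ↔ g.1 = 1 ∧ g.2 ∈ O₂ V := by
  rw [G₂, Subgroup.mem_prod, Subgroup.mem_bot]

theorem mem_O₁ {T : W₁ k ≃ₗ[ℝ] W₁ k} : T ∈ O₁ V ↔
    T ∈ lorentzGroup k ∧ ∀ z ∈ (lorentzForm k).orthogonal (U₁ V), T z = z := by
  rw [O₁, Subgroup.mem_inf, mem_fixingSubgroup_iff]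
  rfl

theorem mem_O₂ {T : W₂ n k ≃ₗ[ℝ] W₂ n k} : T ∈ O₂ V ↔
    T ∈ orthogonalGroup n k ∧ ∀ z ∈ (U₂ V)ᗮ, T z = z := by
  rw [O₂, Subgroup.mem_inf, mem_fixingSubgroup_iff]
  rfl

theorem act_mem_slice_of_mem_G₁ {g : Pairs n k} (hg : g ∈ G₁ V) {z : Ambient n k}
    (hz : z ∈ slice V) : act g z ∈ slice V := by
  obtain ⟨h1, h2⟩ := mem_G₁.1 hg
  obtain ⟨⟨hiso, hpres⟩, hfix⟩ := mem_O₁.1 h1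
  have hz2 : (act g z).2 = z.2 := by rw [act, h2]; rfl
  refine ⟨⟨(hpres _).2 hz.1.1, by rw [hz2]; exact hz.1.2⟩, fun v hv => ?_⟩
  -- The `W₁`-component of a vector of `V` lies in `U₁^⊥`, by the description of `U₁` in `mem_U₁`.
  have hv1 : g.1 v.1 = v.1 := hfix _ fun u hu => by
    rw [lorentzForm_comm]
    exact mem_U₁.1 hu v hv
  have := mem_perp.1 hz.2 v hv
  rw [ambientForm_apply] at this
  rw [ambientForm_apply, hz2]
  change lorentzForm k v.1 (g.1 z.1) + _ = 0
  rw [← hv1, hiso, this]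

theorem act_mem_slice_of_mem_G₂ {g : Pairs n k} (hg : g ∈ G₂ V) {z : Ambient n k}
    (hz : z ∈ slice V) : act g z ∈ slice V := by
  obtain ⟨h1, h2⟩ := mem_G₂.1 hg
  obtain ⟨hiso, hfix⟩ := mem_O₂.1 h2
  replace hiso : ∀ a b, inner ℝ (g.2 a) (g.2 b) = inner ℝ a b := hiso
  have hz1 : (act g z).1 = z.1 := by rw [act, h1]; rfl
  refine ⟨⟨by rw [hz1]; exact hz.1.1, ?_⟩, fun v hv => ?_⟩
  · rw [mem_unitSphere_iff]
    exact (hiso _ _).trans (inner_self_of_mem hz.1.2)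
  have hv2 : g.2 v.2 = v.2 := hfix _ fun u hu => by
    rw [real_inner_comm]
    exact mem_U₂.1 hu v hv
  have := mem_perp.1 hz.2 v hv
  rw [ambientForm_apply] at this
  rw [ambientForm_apply, hz1]
  change _ + inner ℝ v.2 (g.2 z.2) = 0
  rw [← hv2, hiso, this]

theorem sub_mem_U₁ {x x' : W₁ k} {y : W₂ n k} (h : (x, y) ∈ perp V) :
    x' - x ∈ U₁ V ↔ (x', y) ∈ perp V := by
  rw [mem_U₁, mem_perp]
  refine forall₂_congr fun v hv => ?_
  have := mem_perp.1 h v hv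
  rw [ambientForm_apply] at this ⊢
  rw [map_sub]
  constructor <;> intro <;> linarith

theorem sub_mem_U₂ {x : W₁ k} {y y' : W₂ n k} (h : (x, y) ∈ perp V) :
    y' - y ∈ U₂ V ↔ (x, y') ∈ perp V := by
  rw [mem_U₂, mem_perp]
  refine forall₂_congr fun v hv => ?_
  have := mem_perp.1 h v hv
  rw [ambientForm_apply] at this ⊢
  rw [inner_sub_right]
  constructor <;> intro <;> linarith

theorem mem_leaf₁ {y : W₂ n k} {z : Ambient n k} :
    z ∈ (perp V : Set (Ambient n k)) ∩ hyperbolicSpace k ×ˢ {y} ↔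
      z ∈ perp V ∧ z.1 ∈ hyperbolicSpace k ∧ z.2 = y := Iff.rfl

theorem mem_leaf₂ {x : W₁ k} {z : Ambient n k} :
    z ∈ (perp V : Set (Ambient n k)) ∩ {x} ×ˢ unitSphere n k ↔
      z ∈ perp V ∧ z.1 = x ∧ z.2 ∈ unitSphere n k := Iff.rfl

theorem orbit_G₁ {x : W₁ k} {y : W₂ n k} (h : (x, y) ∈ slice V) :
    orbit (G₁ V) (x, y) = (perp V : Set (Ambient n k)) ∩ hyperbolicSpace k ×ˢ {y} := by
  ext ⟨x', y'⟩
  constructor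
  · rintro ⟨g, hg, hgz⟩
    have := act_mem_slice_of_mem_G₁ hg h
    rw [hgz] at this
    refine mem_leaf₁.2 ⟨this.2, this.1.1, ?_⟩
    rw [← hgz, act, (mem_G₁.1 hg).2]
    rfl
  · rintro ⟨hp, hx', rfl⟩
    replace hx' : x' ∈ hyperbolicSpace k := hx'
    -- Since `x' - x ∈ U₁`, an isometry fixing the orthogonal complement of `x' - x` fixes `U₁^⊥`.
    obtain ⟨T, hT, hTx, hfix⟩ := exists_mem_lorentzGroup h.1.1 hx'
    refine ⟨(T, 1), mem_G₁.2 ⟨mem_O₁.2 ⟨hT, fun z hz => hfix z ?_⟩, rfl⟩, Prod.ext hTx rfl⟩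
    exact hz _ ((sub_mem_U₁ h.2).2 hp)

theorem orbit_G₂ {x : W₁ k} {y : W₂ n k} (h : (x, y) ∈ slice V) :
    orbit (G₂ V) (x, y) = (perp V : Set (Ambient n k)) ∩ {x} ×ˢ unitSphere n k := by
  ext ⟨x', y'⟩
  constructor
  · rintro ⟨g, hg, hgz⟩
    have := act_mem_slice_of_mem_G₂ hg h
    rw [hgz] at this
    refine mem_leaf₂.2 ⟨this.2, ?_, this.1.2⟩
    rw [← hgz, act, (mem_G₂.1 hg).1]
    rfl
  · rintro ⟨hp, rfl, hy'⟩
    replace hy' : y' ∈ unitSphere n k := hy'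
    obtain ⟨T, hT, hTy, hfix⟩ := exists_mem_orthogonalGroup h.1.2 hy'
    refine ⟨(1, T), mem_G₂.2 ⟨rfl, mem_O₂.2 ⟨hT, fun z hz => hfix z ?_⟩⟩, Prod.ext rfl hTy⟩
    exact hz _ ((sub_mem_U₂ h.2).2 hp)

end Groups

/-! ### Dimension of the leaves, and umbilicity. -/

section Leaves

/-- If `x` is orthogonal to `U₁`, then `x` is the only point of `ℍ^k ∩ (x + U₁)`. -/
theorem eq_of_forall_orthogonal {U : Submodule ℝ (W₁ k)} {x x' : W₁ k}
    (hx : x ∈ hyperbolicSpace k) (hx' : x' ∈ hyperbolicSpace k)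
    (h : ∀ w ∈ U, lorentzForm k x w = 0) (hd : x' - x ∈ U) : x' = x := by
  by_contra hne
  have h1 := lorentzForm_sub_pos hx hx' (Ne.symm hne)
  have h2 := h _ hd
  -- Orthogonality gives `⟨x, x'⟩ = -1`, so the difference would be isotropic.
  rw [map_sub, hx.1] at h2
  simp only [map_sub, LinearMap.sub_apply, hx.1, hx'.1, lorentzForm_comm x' x] at h1
  linarith

theorem eq_of_forall_inner_eq_zero {U : Submodule ℝ (W₂ n k)} {y y' : W₂ n k}
    (hy : y ∈ unitSphere n k) (hy' : y' ∈ unitSphere n k)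
    (h : ∀ w ∈ U, inner ℝ y w = 0) (hd : y' - y ∈ U) : y' = y := by
  have h2 := h _ hd
  rw [inner_sub_right, inner_self_of_mem hy] at h2
  have h1 : inner ℝ (y' - y) (y' - y) = (0 : ℝ) := by
    rw [inner_sub_left, inner_sub_right, inner_sub_right, inner_self_of_mem hy,
      inner_self_of_mem hy', real_inner_comm y y']
    linarith
  exact sub_eq_zero.1 (inner_self_eq_zero.1 h1)

theorem leaf₁_eq_singleton {x : W₁ k} {y : W₂ n k} (hz : (x, y) ∈ slice V)
    (h : ∀ w ∈ U₁ V, lorentzForm k x w = 0) :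
    (perp V : Set (Ambient n k)) ∩ hyperbolicSpace k ×ˢ {y} = {(x, y)} := by
  ext ⟨x', y'⟩
  constructor
  · rintro ⟨hp, hx', rfl⟩
    exact Prod.ext (eq_of_forall_orthogonal hz.1.1 hx' h ((sub_mem_U₁ hz.2).2 hp)) rfl
  · rintro ⟨⟩
    exact ⟨hz.2, hz.1.1, rfl⟩

theorem leaf₂_eq_singleton {x : W₁ k} {y : W₂ n k} (hz : (x, y) ∈ slice V)
    (h : ∀ w ∈ U₂ V, inner ℝ y w = 0) :
    (perp V : Set (Ambient n k)) ∩ {x} ×ˢ unitSphere n k = {(x, y)} := by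
  ext ⟨x', y'⟩
  constructor
  · rintro ⟨hp, rfl, hy'⟩
    exact Prod.ext rfl (eq_of_forall_inner_eq_zero hz.1.2 hy' h ((sub_mem_U₂ hz.2).2 hp))
  · rintro ⟨⟩
    exact ⟨hz.2, rfl, hz.1.2⟩

/-- A point orthogonal to `U₁` is alone in its leaf, so non-orthogonality at one point spreads over
the whole leaf. -/
theorem exists_not_orthogonal₁ {x x' : W₁ k} {y : W₂ n k} (hz : (x, y) ∈ slice V)
    (h : ∃ w ∈ U₁ V, lorentzForm k x w ≠ 0) (hx' : x' ∈ hyperbolicSpace k)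
    (hp : (x', y) ∈ perp V) : ∃ w ∈ U₁ V, lorentzForm k x' w ≠ 0 := by
  by_contra! hc
  obtain ⟨w, hw, hne⟩ := h
  have : x = x' := eq_of_forall_orthogonal hx' hz.1.1 hc ((sub_mem_U₁ hp).2 hz.2)
  subst this
  exact hne (hc w hw)

theorem exists_not_orthogonal₂ {x : W₁ k} {y y' : W₂ n k} (hz : (x, y) ∈ slice V)
    (h : ∃ w ∈ U₂ V, inner ℝ y w ≠ 0) (hy' : y' ∈ unitSphere n k)
    (hp : (x, y') ∈ perp V) : ∃ w ∈ U₂ V, inner ℝ y' w ≠ 0 := by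
  by_contra! hc
  obtain ⟨w, hw, hne⟩ := h
  have : y = y' := eq_of_forall_inner_eq_zero hy' hz.1.2 hc ((sub_mem_U₂ hp).2 hz.2)
  subst this
  exact hne (hc w hw)

/-- Once the `W₂`-component of the solution is prescribed, the remaining equations pair an unknown
of `W₁` with `x'` and with the `W₁`-components of `V`. These are independent: a vector `w ∈ U₁` with
`⟨x', w⟩ ≠ 0` annihilates the components of `V`, and `V` projects injectively. -/
theorem isSubmanifold_leaf₁ (hV : ∀ v ∈ V, v.1 = 0 → v = 0) {x : W₁ k} {y : W₂ n k}
    (hz : (x, y) ∈ slice V) (h : ∃ w ∈ U₁ V, lorentzForm k x w ≠ 0) {d : ℕ}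
    (hd : d + (1 + ((n + 2 - k) + finrank ℝ V)) = finrank ℝ (Ambient n k)) :
    IsSubmanifold d ((perp V : Set (Ambient n k)) ∩ hyperbolicSpace k ×ˢ {y}) := by
  refine isSubmanifold_of_equations
    ((lorentzForm k).compl₁₂ (LinearMap.fst ℝ _ _) (LinearMap.fst ℝ _ (W₂ n k)))
    (fun _ _ => lorentzForm_comm _ _) ((LinearMap.snd ℝ _ _).prod (pairing V)) (-1) (y, 0)
    isOpen_pos_time ?_ ?_ (by simpa using hd)
  · ext ⟨x', y'⟩
    simp only [mem_leaf₁, Set.mem_ofPred_eq, LinearMap.prod_apply]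
    change _ ∧ (_ ∧ _) ∧ _ ↔ _ ∧ lorentzForm k x' x' = -1 ∧ (y', pairing V (x', y')) = (y, 0)
    rw [Prod.mk.injEq, pairing_eq_zero]
    tauto
  · rintro ⟨x', y'⟩ ⟨hp, hx', rfl⟩ r ⟨b, ξ⟩
    replace hx' : x' ∈ hyperbolicSpace k := hx'
    obtain ⟨w, hw, hne⟩ := exists_not_orthogonal₁ hz h hx' hp
    let T : ℝ × V →ₗ[ℝ] W₁ k :=
      (LinearMap.toSpanSingleton ℝ _ x').coprod (LinearMap.fst ℝ _ _ ∘ₗ V.subtype)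
    have hTa : ∀ a v, T (a, v) = a • x' + (v : Ambient n k).1 := fun a v => by simp [T]
    have hT : Function.Injective T := by
      rw [← LinearMap.ker_eq_bot, eq_bot_iff]
      rintro ⟨a, v, hv⟩ h0
      rw [LinearMap.mem_ker, hTa] at h0
      have h1 := congrArg (fun z => lorentzForm k z w) h0
      simp only [map_add, LinearMap.add_apply, map_smul, LinearMap.smul_apply, map_zero,
        LinearMap.zero_apply, mem_U₁.1 hw v hv, add_zero, smul_eq_mul] at h1
      have ha : a = 0 := (mul_eq_zero.1 h1).resolve_right hne
      subst ha
      have hv0 : v = 0 := hV v hv (by simpa using h0)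
      subst hv0
      simp
    obtain ⟨a, ha⟩ := exists_bilin_eq (lorentzForm k) lorentzForm_comm lorentzForm_nondegenerate
      T hT ((r • LinearMap.id).coprod
        (ξ - (innerₗ (W₂ n k) b) ∘ₗ (LinearMap.snd ℝ (W₁ k) _) ∘ₗ V.subtype))
    refine ⟨(a, b), ?_, Prod.ext rfl ?_⟩
    · have := ha (1, 0)
      simpa [hTa] using this
    · ext v
      have := ha (0, v)
      simp only [hTa, zero_smul, zero_add, LinearMap.coprod_apply, map_zero,
        LinearMap.sub_apply, LinearMap.comp_apply] at this
      change ambientForm n k v (a, b) = ξ v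
      rw [ambientForm_apply, this, real_inner_comm]
      exact sub_add_cancel _ _

theorem isSubmanifold_leaf₂ (hV : ∀ v ∈ V, v.2 = 0 → v = 0) {x : W₁ k} {y : W₂ n k}
    (hz : (x, y) ∈ slice V) (h : ∃ w ∈ U₂ V, inner ℝ y w ≠ 0) {d : ℕ}
    (hd : d + (1 + ((k + 1) + finrank ℝ V)) = finrank ℝ (Ambient n k)) :
    IsSubmanifold d ((perp V : Set (Ambient n k)) ∩ {x} ×ˢ unitSphere n k) := by
  refine isSubmanifold_of_equations
    ((innerₗ (W₂ n k)).compl₁₂ (LinearMap.snd ℝ (W₁ k) _) (LinearMap.snd ℝ (W₁ k) _))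
    (fun _ _ => innerₗ_comm _ _) ((LinearMap.fst ℝ _ _).prod (pairing V)) 1 (x, 0)
    isOpen_univ ?_ ?_ (by simpa using hd)
  · ext ⟨x', y'⟩
    simp only [mem_leaf₂, Set.mem_ofPred_eq, LinearMap.prod_apply,
      mem_unitSphere_iff]
    change _ ∧ _ ∧ _ ↔ True ∧ inner ℝ y' y' = (1 : ℝ) ∧ (x', pairing V (x', y')) = (x, 0)
    rw [Prod.mk.injEq, pairing_eq_zero]
    tauto
  · rintro ⟨x', y'⟩ ⟨hp, rfl, hy'⟩ r ⟨b, ξ⟩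
    replace hy' : y' ∈ unitSphere n k := hy'
    obtain ⟨w, hw, hne⟩ := exists_not_orthogonal₂ hz h hy' hp
    let T : ℝ × V →ₗ[ℝ] W₂ n k :=
      (LinearMap.toSpanSingleton ℝ _ y').coprod (LinearMap.snd ℝ _ _ ∘ₗ V.subtype)
    have hTa : ∀ a v, T (a, v) = a • y' + (v : Ambient n k).2 := fun a v => by simp [T]
    have hT : Function.Injective T := by
      rw [← LinearMap.ker_eq_bot, eq_bot_iff]
      rintro ⟨a, v, hv⟩ h0
      rw [LinearMap.mem_ker, hTa] at h0
      have h1 := congrArg (fun z => inner ℝ z w) h0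
      simp only [inner_add_left, inner_smul_left, inner_zero_left, mem_U₂.1 hw v hv, add_zero] at h1
      have ha : a = 0 := (mul_eq_zero.1 h1).resolve_right hne
      subst ha
      have hv0 : v = 0 := hV v hv (by simpa using h0)
      subst hv0
      simp
    obtain ⟨a, ha⟩ := exists_bilin_eq (innerₗ (W₂ n k)) innerₗ_comm
      (fun z hz => inner_self_eq_zero.1 (hz z))
      T hT ((r • LinearMap.id).coprod
        (ξ - (lorentzForm k b) ∘ₗ (LinearMap.fst ℝ _ (W₂ n k)) ∘ₗ V.subtype))
    refine ⟨(b, a), ?_, Prod.ext rfl ?_⟩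
    · have := ha (1, 0)
      simpa [hTa] using this
    · ext v
      have := ha (0, v)
      simp only [hTa, zero_smul, zero_add, LinearMap.coprod_apply, map_zero,
        LinearMap.sub_apply, LinearMap.comp_apply, innerₗ_apply_apply] at this
      change ambientForm n k v (b, a) = ξ v
      rw [ambientForm_apply, this, lorentzForm_comm]
      exact add_sub_cancel _ _

/-- The leaf through a point that is not orthogonal to `U₁` is umbilical. -/
theorem isUmbilical_leaf₁ (hV : ∀ v ∈ V, v.1 = 0 → v = 0) {x : W₁ k} {y : W₂ n k}
    (hz : (x, y) ∈ slice V) (h : ∃ w ∈ U₁ V, lorentzForm k x w ≠ 0) {d : ℕ}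
    (hd : d + (1 + ((n + 2 - k) + finrank ℝ V)) = finrank ℝ (Ambient n k)) :
    IsUmbilicalSubmanifold (ambientForm n k) (productSpace n k) d
      ((perp V : Set (Ambient n k)) ∩ hyperbolicSpace k ×ˢ {y}) := by
  refine ⟨isSubmanifold_leaf₁ hV hz h hd, ?_, ?_⟩
  · rintro ⟨x', y'⟩ ⟨hp, hx', rfl⟩
    exact ⟨hx', hz.1.2⟩
  rintro ⟨x', y'⟩ ⟨hp, hx', rfl⟩
  replace hx' : x' ∈ hyperbolicSpace k := hx'
  obtain ⟨w₀, hw₀, hne⟩ := exists_not_orthogonal₁ hz h hx' hp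
  have hT : ∀ u ∈ U₁ V ⊓ LinearMap.ker (lorentzForm k x'), u ≠ 0 → 0 < lorentzForm k u u :=
    fun u hu hu0 => lorentzForm_pos_of_orthogonal hx' hu.2 hu0
  -- `U₁` itself may be degenerate, but the tangent space `U₁ ∩ x'^⊥` is space-like. Subtracting the
  -- projection to it makes `w` normal without changing `⟨x', w⟩ = -1`.
  obtain ⟨τ, hτ, hτw⟩ := exists_orthogonal_decomposition (lorentzForm k) lorentzForm_comm _ hT
    (-(lorentzForm k x' w₀)⁻¹ • w₀)
  set w := -(lorentzForm k x' w₀)⁻¹ • w₀ - τ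
  have hw : w ∈ U₁ V := (U₁ V).sub_mem ((U₁ V).smul_mem _ hw₀) hτ.1
  have hxw : lorentzForm k x' w = -1 := by
    have hτx : lorentzForm k x' τ = 0 := hτ.2
    simp only [w, map_sub, map_smul, hτx, smul_eq_mul, sub_zero]
    field_simp
  have htan : ∀ u ∈ U₁ V, lorentzForm k x' u = 0 → ((u, 0) : Ambient n k) ∈
      tangentVectors ((perp V : Set (Ambient n k)) ∩ hyperbolicSpace k ×ˢ {y'}) (x', y') :=
    fun u hu hxu => mem_tangentVectors_left
      (N := (perp V : Set (Ambient n k)) ∩ hyperbolicSpace k ×ˢ {y'}) (x := x') (y := y') (U₁ V)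
      (fun x'' hx'' hd => ⟨(sub_mem_U₁ hp).1 hd, hx'', rfl⟩) hx' hu hw hxu (by rw [hxw]; norm_num)
  -- velocities and accelerations of curves in the leaf
  have hvel : ∀ γ : ℝ → Ambient n k,
      IsCurveThrough ((perp V : Set (Ambient n k)) ∩ hyperbolicSpace k ×ˢ {y'}) (x', y') γ →
      ((deriv γ 0).1 ∈ U₁ V ∧ (deriv γ 0).2 = 0 ∧ lorentzForm k x' (deriv γ 0).1 = 0) ∧
      (deriv (deriv γ) 0).1 ∈ U₁ V ∧ (deriv (deriv γ) 0).2 = 0 ∧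
        lorentzForm k x' (deriv (deriv γ) 0).1 =
          -lorentzForm k (deriv γ 0).1 (deriv γ 0).1 := by
    rintro γ ⟨hs, hγ0, hev⟩
    have h2 := curve_linear hs (LinearMap.snd ℝ (W₁ k) (W₂ n k)) (c := y')
      (hev.mono fun t ht => ht.2.2)
    have hU : ∀ v ∈ V, lorentzForm k v.1 (deriv γ 0).1 = 0 ∧
        lorentzForm k v.1 (deriv (deriv γ) 0).1 = 0 := fun v hv =>
      curve_linear hs ((lorentzForm k v.1) ∘ₗ LinearMap.fst ℝ (W₁ k) (W₂ n k))
        (c := -inner ℝ v.2 y') (hev.mono fun t ht => by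
          have h1 := mem_perp.1 ht.1 v hv
          have h3 : (γ t).2 = y' := ht.2.2
          rw [ambientForm_apply, h3] at h1
          exact eq_neg_of_add_eq_zero_left h1)
    have hq := curve_quadratic hs ((lorentzForm k).compl₁₂ (LinearMap.fst ℝ _ _)
      (LinearMap.fst ℝ _ (W₂ n k))) (fun _ _ => lorentzForm_comm _ _) (c := -1)
      (hev.mono fun t ht => ht.2.1.1)
    rw [hγ0] at hq
    exact ⟨⟨mem_U₁.2 fun v hv => (hU v hv).1, h2.1, hq.1⟩,
      mem_U₁.2 fun v hv => (hU v hv).2, h2.2, hq.2⟩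
  -- Subtracting `x'` makes the vector tangent to `ℍ^k`, since `⟨x', w⟩ = ⟨x', x'⟩ = -1`; products
  -- with vectors tangent to `ℍ^k` are unaffected.
  refine ⟨(w - x', 0), ⟨?_, ?_⟩, ?_⟩
  · exact mem_tangentVectors_left (N := productSpace n k) (x := x') (y := y') ⊤
      (fun x'' hx'' _ => ⟨hx'', hz.1.2⟩) hx' trivial
      (Submodule.mem_top (x := x')) (by rw [map_sub, hxw, hx'.1]; norm_num)
      (by rw [hx'.1]; norm_num)
  · rintro v ⟨γ, hγ, rfl⟩
    obtain ⟨⟨hu, -, hxu⟩, -⟩ := hvel γ hγ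
    rw [ambientForm_apply, inner_zero_right, add_zero, map_sub, hτw _ ⟨hu, hxu⟩,
      lorentzForm_comm, hxu, sub_zero]
  · rintro γ hγ η ⟨hηM, hηN⟩
    obtain ⟨⟨hu, hu2, hxu⟩, ha, ha2, hxa⟩ := hvel γ hγ
    obtain ⟨hη1, -⟩ := tangent_productSpace hηM
    set u := (deriv γ 0).1
    set a := (deriv (deriv γ) 0).1
    have hdec := hηN _ (htan (a - lorentzForm k u u • w)
      ((U₁ V).sub_mem ha ((U₁ V).smul_mem _ hw)) (by
        rw [map_sub, map_smul, hxw, hxa]; simp))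
    simp only [ambientForm_apply, inner_zero_left, add_zero, map_sub, map_smul,
      LinearMap.sub_apply, LinearMap.smul_apply, smul_eq_mul] at hdec
    simp only [ambientForm_apply, hu2, ha2, inner_zero_left, add_zero, map_sub,
      LinearMap.sub_apply, hη1, sub_zero]
    linarith

end Leaves

/-! ### Regular points and round spheres. -/

section Regular

theorem finrank_U₂ (hV : ∀ v ∈ V, v.2 = 0 → v = 0) :
    finrank ℝ V + finrank ℝ (U₂ V) = n + 2 - k := by
  have hU : U₂ V = (V.map (LinearMap.snd ℝ (W₁ k) (W₂ n k)))ᗮ := by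
    ext u
    rw [mem_U₂, Submodule.mem_orthogonal]
    simp only [Submodule.mem_map, forall_exists_index, and_imp, forall_apply_eq_imp_iff₂]
    rfl
  have hinj : Function.Injective ((LinearMap.snd ℝ (W₁ k) (W₂ n k)).domRestrict V) := by
    rw [← LinearMap.ker_eq_bot, eq_bot_iff]
    rintro ⟨v, hv⟩ h0
    simpa using hV v hv h0
  have hfin : finrank ℝ (V.map (LinearMap.snd ℝ (W₁ k) (W₂ n k))) = finrank ℝ V := by
    rw [← LinearMap.range_domRestrict, LinearMap.finrank_range_of_inj hinj]
  rw [hU, ← hfin, Submodule.finrank_add_finrank_orthogonal]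
  simp

theorem exists_ne_zero_mem_U₁ (h : finrank ℝ V < k + 1) : ∃ u ∈ U₁ V, u ≠ 0 := by
  have hker := LinearMap.ker_ne_bot_of_finrank_lt
    (f := pairing V ∘ₗ LinearMap.inl ℝ (W₁ k) (W₂ n k)) (by simpa using h)
  obtain ⟨u, hu, hu0⟩ := Submodule.exists_mem_ne_zero_of_ne_bot hker
  exact ⟨u, pairing_eq_zero.1 hu, hu0⟩

theorem exists_ne_zero_mem_U₂ (h : finrank ℝ V < n + 2 - k) : ∃ u ∈ U₂ V, u ≠ 0 := by
  have hker := LinearMap.ker_ne_bot_of_finrank_lt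
    (f := pairing V ∘ₗ LinearMap.inr ℝ (W₁ k) (W₂ n k)) (by simpa using h)
  obtain ⟨u, hu, hu0⟩ := Submodule.exists_mem_ne_zero_of_ne_bot hker
  exact ⟨u, pairing_eq_zero.1 hu, hu0⟩

/-- Take a nonzero `u ∈ U₁`. If `u` is space-like, substantiality gives a point not orthogonal to
it; otherwise no point of `ℍ^k` is orthogonal to `u`, and any point of `S` serves. -/
theorem exists_mem_slice_not_orthogonal₁ (hkn : k ≤ n + 1)
    (hS : IsSubstantial (ambientForm n k) (productSpace n k) (n + 1) (slice V))
    (h : finrank ℝ V < k + 1) :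
    ∃ x y, (x, y) ∈ slice V ∧ ∃ w ∈ U₁ V, lorentzForm k x w ≠ 0 := by
  obtain ⟨u, hu, hu0⟩ := exists_ne_zero_mem_U₁ h
  by_cases hpos : 0 < lorentzForm k u u
  · obtain ⟨⟨x, y⟩, hz, hne⟩ := exists_mem_slice_ne hkn hS (u := (u, 0))
      (by simpa [ambientForm_apply] using hpos) (Or.inr rfl)
    refine ⟨x, y, hz, u, hu, ?_⟩
    rw [lorentzForm_comm]
    simpa [ambientForm_apply] using hne
  · obtain ⟨⟨x, y⟩, hz⟩ := slice_nonempty hS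
    exact ⟨x, y, hz, u, hu, fun h0 => hpos (lorentzForm_pos_of_orthogonal hz.1.1 h0 hu0)⟩

theorem exists_mem_slice_not_orthogonal₂ (hkn : k ≤ n + 1)
    (hS : IsSubstantial (ambientForm n k) (productSpace n k) (n + 1) (slice V))
    (h : finrank ℝ V < n + 2 - k) :
    ∃ x y, (x, y) ∈ slice V ∧ ∃ w ∈ U₂ V, inner ℝ y w ≠ 0 := by
  obtain ⟨u, hu, hu0⟩ := exists_ne_zero_mem_U₂ h
  obtain ⟨⟨x, y⟩, hz, hne⟩ := exists_mem_slice_ne hkn hS (u := (0, u))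
    (by simpa [ambientForm_apply] using pow_pos (norm_pos_iff.2 hu0) 2) (Or.inl rfl)
  refine ⟨x, y, hz, u, hu, ?_⟩
  rw [real_inner_comm]
  simpa [ambientForm_apply] using hne

/-- A regular point is not alone in its orbit. -/
theorem IsRegularPoint.orbit_ne_singleton {G : Subgroup (Pairs n k)} {S : Set (Ambient n k)}
    {z z' : Ambient n k} (h : IsRegularPoint G S z) (hz' : z' ∈ S) {d : ℕ} (hd : 0 < d)
    (hsub : IsSubmanifold d (orbit G z')) : orbit G z ≠ {z} := by
  intro heq
  obtain ⟨-, e, he, hmax⟩ := h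
  rw [heq] at he
  have := hmax z' hz' d hsub
  have := he.eq_zero_of_singleton
  omega

/-- The leaf through a point that is not orthogonal to `U₂` is a round sphere. -/
theorem exists_isRoundSphere {x : W₁ k} {y : W₂ n k} (hz : (x, y) ∈ slice V)
    (h : ∃ w ∈ U₂ V, inner ℝ y w ≠ 0) {d : ℕ} (hd : finrank ℝ (U₂ V) = d + 1) :
    ∃ N : Set (W₂ n k), IsRoundSphere d N ∧
      (perp V : Set (Ambient n k)) ∩ {x} ×ˢ unitSphere n k = {x} ×ˢ N := by
  -- The centre is the foot `y - q` of the perpendicular from the origin to `y + U₂`; Pythagoras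
  -- gives the radius `‖q‖`, positive since `y` is not orthogonal to `U₂`.
  set q := (U₂ V).starProjection y with hq
  have hqU : q ∈ U₂ V := Submodule.starProjection_apply_mem _ _
  have hc : y - q ∈ (U₂ V)ᗮ := Submodule.sub_starProjection_mem_orthogonal y
  have hq0 : q ≠ 0 := by
    intro h0
    obtain ⟨w, hw, hne⟩ := h
    rw [h0, sub_zero] at hc
    exact hne (by rw [real_inner_comm]; exact hc w hw)
  have hnorm : ∀ y', y' - (y - q) ∈ U₂ V →
      ‖y'‖ ^ 2 = ‖y' - (y - q)‖ ^ 2 + ‖y - q‖ ^ 2 := by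
    intro y' hy'
    have := norm_add_sq_real (y' - (y - q)) (y - q)
    rw [hc _ hy', sub_add_cancel] at this
    linarith
  have hy1 : ‖y‖ = 1 := hz.1.2
  have hyq := hnorm y (by simpa using hqU)
  rw [sub_sub_cancel, hy1] at hyq
  refine ⟨_, ⟨y - q, ‖q‖, U₂ V, norm_pos_iff.2 hq0, hd, rfl⟩, ?_⟩
  have hiff : ∀ y', y' - (y - q) ∈ U₂ V ↔ y' - y ∈ U₂ V := fun y' => by
    rw [← sub_add]
    exact (U₂ V).add_mem_iff_left hqU
  ext ⟨x', y'⟩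
  rw [mem_leaf₂, Set.mem_prod]
  simp only [Set.mem_singleton_iff, Set.mem_ofPred_eq]
  rw [hiff]
  constructor
  · rintro ⟨hp, rfl, hy'⟩
    have hU := (sub_mem_U₂ hz.2).2 hp
    have h1 := hnorm y' ((hiff y').2 hU)
    rw [show ‖y'‖ = 1 from hy'] at h1
    exact ⟨rfl, hU, (sq_eq_sq₀ (norm_nonneg _) (norm_nonneg _)).1 (by linarith)⟩
  · rintro ⟨rfl, hU, hr⟩
    have h1 := hnorm y' ((hiff y').2 hU)
    rw [hr] at h1
    exact ⟨(sub_mem_U₂ hz.2).1 hU, rfl,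
      (sq_eq_sq₀ (norm_nonneg _) zero_le_one).1 (by linarith)⟩

end Regular

end UmbilicalRotation

theorem mainTheorem12 (n k p : ℕ) (hk : 1 ≤ k) (hkn : k ≤ n + 1)
    (V : Submodule ℝ (Ambient n k)) (hV : IsSpacelike (ambientForm n k) V)
    (hp : finrank ℝ V = p)
    (hS : IsSubstantial (ambientForm n k) (productSpace n k) (n + 1) (slice V)) :
    (p + 1 ≤ k →
      LeavesInvariant (G₁ V) (slice V) ∧
      HasCohomogeneity (G₁ V) (slice V) (n + 1 - k) ∧
      (∀ x y, (x, y) ∈ slice V →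
        orbit (G₁ V) (x, y) = (perp V : Set (Ambient n k)) ∩ hyperbolicSpace k ×ˢ {y}) ∧
      (∀ x y, IsRegularPoint (G₁ V) (slice V) (x, y) →
        IsUmbilicalSubmanifold (ambientForm n k) (productSpace n k) (k - p)
          ((perp V : Set (Ambient n k)) ∩ hyperbolicSpace k ×ˢ {y}))) ∧
    (p + k ≤ n →
      LeavesInvariant (G₂ V) (slice V) ∧
      HasCohomogeneity (G₂ V) (slice V) k ∧
      (∀ x y, (x, y) ∈ slice V →
        orbit (G₂ V) (x, y) = (perp V : Set (Ambient n k)) ∩ {x} ×ˢ unitSphere n k) ∧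
      (∀ x y, IsRegularPoint (G₂ V) (slice V) (x, y) →
        ∃ N : Set (W₂ n k), IsRoundSphere (n + 1 - k - p) N ∧
          (perp V : Set (Ambient n k)) ∩ {x} ×ˢ unitSphere n k = {x} ×ˢ N)) := by
  subst hp
  have hV1 : ∀ v ∈ V, v.1 = 0 → v = 0 := fun v hv h =>
    eq_zero_of_component_eq_zero hkn hS hV hv (Or.inl h)
  have hV2 : ∀ v ∈ V, v.2 = 0 → v = 0 := fun v hv h =>
    eq_zero_of_component_eq_zero hkn hS hV hv (Or.inr h)
  refine ⟨fun hpk => ?_, fun hpn => ?_⟩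
  · have hd : k - finrank ℝ V + (1 + ((n + 2 - k) + finrank ℝ V)) =
        finrank ℝ (Ambient n k) := by rw [finrank_ambient]; omega
    obtain ⟨x₀, y₀, hz₀, h₀⟩ := exists_mem_slice_not_orthogonal₁ hkn hS (by omega)
    have hsub₀ : IsSubmanifold (k - finrank ℝ V) (orbit (G₁ V) (x₀, y₀)) := by
      rw [orbit_G₁ hz₀]; exact isSubmanifold_leaf₁ hV1 hz₀ h₀ hd
    refine ⟨leavesInvariant_of_forall fun g hg z hz => act_mem_slice_of_mem_G₁ hg hz,
      ⟨k - finrank ℝ V, isSubmanifold_slice hV (by rw [finrank_ambient]; omega),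
        ⟨_, hz₀, hsub₀⟩, ?_⟩, fun x y hz => orbit_G₁ hz, fun x y hreg => ?_⟩
    · rintro ⟨x, y⟩ hz
      rw [orbit_G₁ hz]
      by_cases h : ∃ w ∈ U₁ V, lorentzForm k x w ≠ 0
      · exact ⟨_, le_rfl, isSubmanifold_leaf₁ hV1 hz h hd⟩
      · push Not at h
        rw [leaf₁_eq_singleton hz h]
        exact ⟨0, Nat.zero_le _, isSubmanifold_singleton _⟩
    · refine isUmbilical_leaf₁ hV1 hreg.1 ?_ hd
      by_contra! h
      -- Here `p + 1 ≤ k` matters: the dimension `k - p` of the orbit of `(x₀, y₀)` is positive, so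
      -- a singleton orbit is not maximal.
      exact hreg.orbit_ne_singleton hz₀ (by omega) hsub₀
        ((orbit_G₁ hreg.1).trans (leaf₁_eq_singleton hreg.1 h))
  · have hd : n + 1 - k - finrank ℝ V + (1 + ((k + 1) + finrank ℝ V)) =
        finrank ℝ (Ambient n k) := by rw [finrank_ambient]; omega
    obtain ⟨x₀, y₀, hz₀, h₀⟩ := exists_mem_slice_not_orthogonal₂ hkn hS (by omega)
    have hsub₀ : IsSubmanifold (n + 1 - k - finrank ℝ V) (orbit (G₂ V) (x₀, y₀)) := by
      rw [orbit_G₂ hz₀]; exact isSubmanifold_leaf₂ hV2 hz₀ h₀ hd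
    refine ⟨leavesInvariant_of_forall fun g hg z hz => act_mem_slice_of_mem_G₂ hg hz,
      ⟨n + 1 - k - finrank ℝ V, isSubmanifold_slice hV (by rw [finrank_ambient]; omega),
        ⟨_, hz₀, hsub₀⟩, ?_⟩, fun x y hz => orbit_G₂ hz, fun x y hreg => ?_⟩
    · rintro ⟨x, y⟩ hz
      rw [orbit_G₂ hz]
      by_cases h : ∃ w ∈ U₂ V, inner ℝ y w ≠ 0
      · exact ⟨_, le_rfl, isSubmanifold_leaf₂ hV2 hz h hd⟩
      · push Not at h
        rw [leaf₂_eq_singleton hz h]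
        exact ⟨0, Nat.zero_le _, isSubmanifold_singleton _⟩
    · refine exists_isRoundSphere hreg.1 ?_ (by have := finrank_U₂ hV2; omega)
      by_contra! h
      exact hreg.orbit_ne_singleton hz₀ (by omega) hsub₀
        ((orbit_G₂ hreg.1).trans (leaf₂_eq_singleton hreg.1 h))
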